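/- Let $k\ge 0$ be an integer, let $\mathbb{F}_k$ be the free group on $k$ generators $w_1,\dots,w_k$, and let $\widehat{\mathbb{F}}_k$ be its profinite completion with its Haar probability measure. Let $N_0=\mathrm{Clop}(\widehat{\mathbb{F}}_k)$ be the Boolean algebra of clopen subsets of $\widehat{\mathbb{F}}_k$ with the restriction of the Haar measure, let $N_1$ be the measured Boolean algebra generated by the rational subintervals of the unit interval with Lebesgue measure (modulo null sets; equivalently, the algebra of subsets of $[0,1)$ generated by the half-open intervals $[p,q)$ with $p,q$ rational), and let $N=N_0\otimes N_1$ be the product algebra, generated by the rectangles $a\otimes b$ with $a\in N_0$, $b\in N_1$, with the product measure $\mu$. Regard $N$ as a classical first-order structure in the language $\{\cap,\cup,\triangle,\mathbf 0,\mathbf 1\}$ expanded by unary predicates $\mu_r$, $r\in\mathbb{Q}\cap[0,1]$, where $\mu_r(a)$ holds iff $\mu(a)=r$, and let $H=\mathrm{Aut}(N)$ be its automorphism group with the topology of pointwise convergence, $N$ being discrete. Then: (1) $N$ is countable and is the Fraïssé limit of the class $\mathcal{MBA}_{\mathbb{Q}}$ of finite Boolean algebras with a strictly positive, rational-valued, finitely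 additive probability measure; that is, $N$ is ultrahomogeneous and the finitely generated structures that embed into $N$ are, up to isomorphism, exactly the members of $\mathcal{MBA}_{\mathbb{Q}}$. (2) The action of $\mathbb{F}_k$ on $N$ induced by left translation on $\widehat{\mathbb{F}}_k$ and the trivial action on $N_1$, so that $w(a\otimes b)=(wa)\otimes b$ for $w\in\mathbb{F}_k$, $a\in N_0$, $b\in N_1$, is generic: if $g_i\in H$ is the automorphism of $N$ given by $w_i$, then the diagonal conjugacy class $\{(hg_1h^{-1},\dots,hg_kh^{-1}) : h\in H\}$ is comeager in $H^k$. -/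

import Mathlib

open MeasureTheory
open scoped FirstOrder

namespace PmpFree

/-! ### Classical structures: automorphism groups and generic actions -/

section Aut

variable {L : FirstOrder.Language.{0, 0}} {M : Type} [L.Structure M]

/-- The automorphisms of a structure form a group under composition. -/
instance autGroup : Group (M ≃[L] M) where
  mul f g := f.comp g
  one := FirstOrder.Language.Equiv.refl L M
  inv f := f.symm
  mul_assoc _ _ _ := rfl
  one_mul _ := rfl
  mul_one _ := rfl
  inv_mul_cancel f := FirstOrder.Language.Equiv.ext fun x => f.symm_apply_apply x

/-- The topology of pointwise convergence on the automorphism group of a classical structure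
(whose domain is discrete): it is induced by the product topology on `M → M`, where `M` carries
the discrete topology `⊥`. -/
instance autTopology : TopologicalSpace (M ≃[L] M) :=
  TopologicalSpace.induced (fun (g : M ≃[L] M) (x : M) => g x)
    (@Pi.topologicalSpace M (fun _ => M) (fun _ => ⊥))

/-- The orbit of a tuple of automorphisms under diagonal conjugation. -/
def diagonalConjClass {k : ℕ} (g : Fin k → (M ≃[L] M)) : Set (Fin k → (M ≃[L] M)) :=
  {f | ∃ h : M ≃[L] M, ∀ i, f i = h * g i * h⁻¹}

/-- An action of the free group of rank `k` on a classical structure by automorphisms is generic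
if the diagonal conjugacy class of the tuple given by the free generators is comeager in the
`k`-th power of the automorphism group. -/
def IsGenericAction {k : ℕ} (ρ : FreeGroup (Fin k) →* (M ≃[L] M)) : Prop :=
  diagonalConjClass (fun i => ρ (FreeGroup.of i)) ∈ residual (Fin k → (M ≃[L] M))

end Aut

/-! ### Measured Boolean algebras as classical structures -/

/-- The function symbols of the language of Boolean algebras. -/
inductive MBAFun : ℕ → Type
  | zero : MBAFun 0
  | one : MBAFun 0
  | inter : MBAFun 2
  | union : MBAFun 2
  | symmDiff : MBAFun 2

/-- The unary predicates `μ_r`, for `r` rational in `[0,1]`. -/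
inductive MBARel : ℕ → Type
  | measure (r : Set.Icc (0 : ℚ) 1) : MBARel 1

/-- The language of measured Boolean algebras. -/
def mbaLang : FirstOrder.Language.{0, 0} := ⟨MBAFun, MBARel⟩

instance countable_mbaLang_functions : Countable (Σ l, mbaLang.Functions l) := by
  have h : Function.Surjective (fun i : Fin 5 =>
      (![⟨0, MBAFun.zero⟩, ⟨0, MBAFun.one⟩, ⟨2, MBAFun.inter⟩, ⟨2, MBAFun.union⟩,
        ⟨2, MBAFun.symmDiff⟩] i : Σ l, MBAFun l)) := by
    rintro ⟨_, f⟩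
    cases f
    exacts [⟨0, rfl⟩, ⟨1, rfl⟩, ⟨2, rfl⟩, ⟨3, rfl⟩, ⟨4, rfl⟩]
  exact h.countable

/-- A Boolean algebra `B` with a real-valued function `m` as a classical structure: the predicate
`μ_r` holds of `a` iff `m a = r`. -/
@[reducible] def mbaStructure (B : Type) [BooleanAlgebra B] (m : B → ℝ) : mbaLang.Structure B where
  funMap := fun {_} f => match f with
    | MBAFun.zero => fun _ => ⊥
    | MBAFun.one => fun _ => ⊤
    | MBAFun.inter => fun x => x 0 ⊓ x 1
    | MBAFun.union => fun x => x 0 ⊔ x 1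
    | MBAFun.symmDiff => fun x => symmDiff (x 0) (x 1)
  RelMap := fun {_} R => match R with
    | MBARel.measure r => fun x => m (x 0) = ((r : ℚ) : ℝ)

/-- `m` is a strictly positive finitely additive probability measure on the Boolean algebra `B`
with rational values. -/
structure IsRationalMeasure {B : Type} [BooleanAlgebra B] (m : B → ℝ) : Prop where
  top : m ⊤ = 1
  add : ∀ a b : B, Disjoint a b → m (a ⊔ b) = m a + m b
  pos : ∀ a : B, a ≠ ⊥ → 0 < m a
  rational : ∀ a : B, ∃ q : ℚ, m a = (q : ℝ)

/-- The class of finite measure algebras with rational-valued measures (closed under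
isomorphism). -/
def mbaQ : Set (CategoryTheory.Bundled.{0} mbaLang.Structure) :=
  {S | ∃ (B : Type) (_ : BooleanAlgebra B) (m : B → ℝ), Finite B ∧ IsRationalMeasure m ∧
    letI : mbaLang.Structure B := mbaStructure B m
    Nonempty (S ≃[mbaLang] B)}

/-! ### Algebras of sets -/

section SetAlgebra

variable {X Y : Type}

/-- The tensor product of two algebras of sets: the algebra of subsets of `X × Y` generated by
the rectangles `a ⊗ b = a ×ˢ b`. -/
def tensor (A : BooleanSubalgebra (Set X)) (B : BooleanSubalgebra (Set Y)) :
    BooleanSubalgebra (Set (X × Y)) :=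
  BooleanSubalgebra.closure {c | ∃ a ∈ A, ∃ b ∈ B, c = a ×ˢ b}

/-- The algebra of clopen subsets of a topological space. -/
def clop (X : Type) [TopologicalSpace X] : BooleanSubalgebra (Set X) where
  carrier := {a | IsClopen a}
  supClosed' _ ha _ hb := IsClopen.union ha hb
  infClosed' _ ha _ hb := IsClopen.inter ha hb
  compl_mem' ha := IsClopen.compl ha
  bot_mem' := isClopen_empty

/-- An algebra of sets, together with the restriction of a measure, as a classical structure. -/
instance setAlgStructure {Ω : Type} [MeasureSpace Ω] (N : BooleanSubalgebra (Set Ω)) :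
    mbaLang.Structure N :=
  mbaStructure N fun a => (volume : Measure Ω).real (a : Set Ω)

/-- A measure-preserving bijection of `Ω` whose direct and inverse images map `N` into itself
induces an automorphism of the measured algebra `N`. -/
def imageAut {Ω : Type} [MeasureSpace Ω] (N : BooleanSubalgebra (Set Ω)) (e : Ω ≃ Ω)
    (h₁ : ∀ a ∈ N, e '' a ∈ N) (h₂ : ∀ a ∈ N, e.symm '' a ∈ N)
    (hμ : ∀ a ∈ N, (volume : Measure Ω).real (e '' a) = (volume : Measure Ω).real a) :
    N ≃[mbaLang] N where
  toFun a := ⟨e '' a, h₁ a a.2⟩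
  invFun a := ⟨e.symm '' a, h₂ a a.2⟩
  left_inv a := Subtype.ext (by simp [Set.image_image])
  right_inv a := Subtype.ext (by simp [Set.image_image])
  map_fun' := fun {_} f x => by
    apply Subtype.ext
    cases f
    · exact Set.image_empty e
    · exact Set.image_univ_of_surjective e.surjective
    · exact Set.image_inter e.injective
    · exact Set.image_union e _ _
    · exact Set.image_symmDiff e.injective _ _
  map_rel' := fun {_} R x => by
    cases R with
    | measure r =>
      change (volume : Measure Ω).real (e '' (x 0 : Set Ω)) = _ ↔
        (volume : Measure Ω).real (x 0 : Set Ω) = _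
      rw [hμ _ (x 0).2]

end SetAlgebra

/-! ### The profinite completion of a free group and the algebra `N` -/

/-- The profinite completion of the free group of rank `k`. -/
abbrev FHat (k : ℕ) : Type :=
  (ProfiniteGrp.ProfiniteCompletion.completion (GrpCat.of (FreeGroup (Fin k))) : ProfiniteGrp.{0})

/-- The canonical homomorphism from the free group into its profinite completion. -/
def toFHat (k : ℕ) : FreeGroup (Fin k) →* FHat k :=
  (ProfiniteGrp.ProfiniteCompletion.eta (GrpCat.of (FreeGroup (Fin k)))).hom

/-- The Borel `σ`-algebra and the Haar probability measure on the profinite completion. -/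
noncomputable instance fHatMeasureSpace (k : ℕ) : MeasureSpace (FHat k) :=
  letI : MeasurableSpace (FHat k) := borel (FHat k)
  haveI : BorelSpace (FHat k) := ⟨rfl⟩
  ⟨Measure.haarMeasure ⊤⟩

instance fHatBorelSpace (k : ℕ) : BorelSpace (FHat k) := ⟨rfl⟩

/-- The half-open unit interval `[0,1)`. -/
abbrev UnitIco : Type := Set.Ico (0 : ℝ) 1

/-- `[0,1)` carries the Lebesgue measure. -/
noncomputable instance unitIcoMeasureSpace : MeasureSpace UnitIco := Measure.Subtype.measureSpace

instance unitIcoProbability : IsProbabilityMeasure (volume : Measure UnitIco) := by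
  constructor
  change Measure.comap Subtype.val (volume : Measure ℝ) Set.univ = 1
  rw [comap_subtype_coe_apply measurableSet_Ico, Set.image_univ, Subtype.range_coe,
    Real.volume_Ico]
  norm_num

/-- The algebra `N₁` generated by the rational subintervals of the unit interval. In the measure
algebra of the unit interval the endpoints of an interval are irrelevant; the half-open intervals
`[p,q)` in `[0,1)` generate an algebra of sets without nonempty null sets, hence one that is
isomorphic to the subalgebra of the measure algebra generated by the rational intervals. -/
def ratAlg : BooleanSubalgebra (Set UnitIco) :=
  BooleanSubalgebra.closure {s | ∃ p q : ℚ, s = {x | (p : ℝ) ≤ x.1 ∧ x.1 < (q : ℝ)}}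

/-- The algebra `N = Clop(F̂ₖ) ⊗ N₁`. It is a measured algebra through the product of the Haar
measure and the Lebesgue measure, which is the `volume` of the product space. -/
def algN (k : ℕ) : BooleanSubalgebra (Set (FHat k × UnitIco)) := tensor (clop (FHat k)) ratAlg

/-- Left translation by `w` on the first factor, the identity on the second one. -/
noncomputable def translate (k : ℕ) (w : FreeGroup (Fin k)) :
    (FHat k × UnitIco) ≃ᵐ (FHat k × UnitIco) :=
  (MeasurableEquiv.mulLeft (toFHat k w)).prodCongr (MeasurableEquiv.refl UnitIco)

theorem translate_apply (k : ℕ) (w : FreeGroup (Fin k)) (z : FHat k × UnitIco) :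
    translate k w z = (toFHat k w * z.1, z.2) := rfl

theorem translate_symm (k : ℕ) (w : FreeGroup (Fin k)) :
    (translate k w).symm = translate k w⁻¹ := by
  refine MeasurableEquiv.ext (funext fun z => ?_)
  apply (translate k w).injective
  rw [MeasurableEquiv.apply_symm_apply, translate_apply, translate_apply, map_inv,
    mul_inv_cancel_left]

theorem image_translate_mem (k : ℕ) (w : FreeGroup (Fin k)) :
    ∀ a ∈ algN k, translate k w '' a ∈ algN k := by
  intro a ha
  induction ha using BooleanSubalgebra.closure_bot_sup_induction with
  | mem x hx =>
    obtain ⟨c, hc, b, hb, rfl⟩ := hx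
    refine BooleanSubalgebra.subset_closure ⟨(fun x => toFHat k w * x) '' c, ?_, b, hb, ?_⟩
    · exact ⟨(Homeomorph.mulLeft (toFHat k w)).isClosed_image.2 hc.1,
        (Homeomorph.mulLeft (toFHat k w)).isOpen_image.2 hc.2⟩
    · ext ⟨y, t⟩
      constructor
      · rintro ⟨⟨y', t'⟩, ⟨h1, h2⟩, h⟩
        cases h
        exact ⟨⟨y', h1, rfl⟩, h2⟩
      · rintro ⟨⟨y', h1, h⟩, h2⟩
        exact ⟨(y', t), ⟨h1, h2⟩, Prod.ext h rfl⟩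
  | bot =>
    have : translate k w '' (⊥ : Set (FHat k × UnitIco)) = ⊥ := Set.image_empty _
    rw [this]
    exact BooleanSubalgebra.bot_mem
  | sup x hx y hy h1 h2 =>
    have : translate k w '' (x ⊔ y) = translate k w '' x ⊔ translate k w '' y :=
      Set.image_union _ _ _
    rw [this]
    exact BooleanSubalgebra.sup_mem h1 h2
  | compl x hx h =>
    rw [Set.image_compl_eq (translate k w).bijective]
    exact BooleanSubalgebra.compl_mem h

theorem measure_image_translate (k : ℕ) (w : FreeGroup (Fin k)) (a : Set (FHat k × UnitIco)) :
    (volume : Measure (FHat k × UnitIco)).real (translate k w '' a) =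
      (volume : Measure (FHat k × UnitIco)).real a := by
  have : (volume : Measure (FHat k)).IsHaarMeasure :=
    inferInstanceAs ((Measure.haarMeasure ⊤ : Measure (FHat k)).IsHaarMeasure)
  have h : MeasurePreserving (translate k w⁻¹) :=
    (measurePreserving_mul_left (volume : Measure (FHat k)) (toFHat k w⁻¹)).prod
      (MeasurePreserving.id (volume : Measure UnitIco))
  rw [Measure.real, Measure.real, ← h.measure_preimage_equiv a, ← translate_symm,
    MeasurableEquiv.image_eq_preimage_symm]

/-- The "profinite completion times trivial" action of the free group on `N`: an element `w`
sends `a` to its image under left translation by `w` on the profinite completion, times the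
identity. -/
noncomputable def profiniteTimesTrivial (k : ℕ) :
    FreeGroup (Fin k) →* (algN k ≃[mbaLang] algN k) where
  toFun w := imageAut (algN k) (translate k w).toEquiv (image_translate_mem k w)
    (fun a ha => by
      have h := image_translate_mem k w⁻¹ a ha
      rw [← translate_symm] at h
      exact h)
    (fun a _ => measure_image_translate k w a)
  map_one' := FirstOrder.Language.Equiv.ext fun a => Subtype.ext <| by
    change translate k 1 '' (a : Set _) = a
    have : ⇑(translate k 1) = id := by
      funext z
      rw [translate_apply, map_one, one_mul]
      rfl
    rw [this, Set.image_id]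
  map_mul' v w := FirstOrder.Language.Equiv.ext fun a => Subtype.ext <| by
    change translate k (v * w) '' (a : Set _) = translate k v '' (translate k w '' (a : Set _))
    rw [Set.image_image]
    congr 1
    funext z
    simp only [translate_apply, map_mul, mul_assoc]

end PmpFree

set_option linter.unusedSectionVars false

namespace PmpFree

/-! ### A back-and-forth criterion for a comeager diagonal conjugacy class -/

section GenericCriterion

variable {L : FirstOrder.Language.{0, 0}} {M : Type} [L.Structure M]

/-! Everything rests on cells. An open normal subgroup `U` of the profinite group and an integer `m
≥ 1` cut `G × [0,1)` into products of a coset of `U` with an interval `[j/m, (j+1)/m)`. Each member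
of the algebra is a union of cells at some level `(U, m)` (`exists_isLevel`), finitely many members
share a level, and the cells of one level have equal measure. Hence two maps to a finite set with
the same distribution have equally many cells over each value. A permutation of cells matches them,
and it induces an automorphism because all cells of a level have the same internal structure
(`exists_aut_of_distribution_eq`).

Applied to membership patterns with respect to finitely many generators, this gives
ultrahomogeneity. A finitely generated substructure consists of unions of cells of one level, so it
is finite with rational measure. Conversely, the atoms of a finite rational measured algebra can be
realized by subdividing the interval alone.

For genericity, `diagonalConjClass_mem_residual` reduces the claim to a finite problem: if a tuple
`f` agrees with the action `g` on a finite invariant set `D`, then on any finite set `A` it is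
conjugate to `g` by an automorphism fixing `D`. At a level fine enough for `D`, `A` and their
images, each `f i` is implemented by a permutation `σ i` of the cells. These permutations extend to
a homomorphism `ρ` from the profinite completion to the finite symmetric group. With `F` a suitable
map from the interval to the cells, `φ (z, t) = ρ z (F t)` is equivariant, so it realizes the finite
system `σ` inside the profinite action (`exists_equivariant_map`). Over `D`, `F` is forced to agree
with the cells met by `{1} × [0,1)`, and the remaining freedom is used to randomize `F` among the
cells not separated by `D` (`exists_equidistributed_lift`). Then `φ` has the same distribution as
the cell map, and the automorphism carrying the cell map to `φ` is the required conjugation. -/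

theorem aut_mul_apply (f g : M ≃[L] M) (x : M) : (f * g) x = f (g x) := rfl

theorem aut_inv_apply_self (f : M ≃[L] M) (x : M) : f⁻¹ (f x) = x := f.symm_apply_apply x

theorem aut_apply_inv_self (f : M ≃[L] M) (x : M) : f (f⁻¹ x) = x := f.apply_symm_apply x

theorem isOpen_setOf_apply_mem (x : M) (s : Set M) : IsOpen {f : M ≃[L] M | f x ∈ s} := by
  let _ : TopologicalSpace M := ⊥
  have : DiscreteTopology M := ⟨rfl⟩
  refine isOpen_induced_iff.2 ⟨(fun u : M → M => u x) ⁻¹' s, ?_, rfl⟩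
  exact (isOpen_discrete s).preimage (continuous_apply x)

theorem isClopen_setOf_apply_mem (x : M) (s : Set M) : IsClopen {f : M ≃[L] M | f x ∈ s} :=
  ⟨⟨isOpen_setOf_apply_mem x sᶜ⟩, isOpen_setOf_apply_mem x s⟩

/-- Basic neighbourhoods in the topology of pointwise convergence. -/
theorem exists_finset_of_mem_open {k : ℕ} {V : Set (Fin k → (M ≃[L] M))} (hV : IsOpen V)
    {f : Fin k → (M ≃[L] M)} (hf : f ∈ V) :
    ∃ A : Finset M, ∀ f' : Fin k → (M ≃[L] M), (∀ i, ∀ a ∈ A, f' i a = f i a) → f' ∈ V := by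
  classical
  obtain ⟨I, u, hu, hI⟩ := isOpen_pi_iff.1 hV f hf
  have key : ∀ i : Fin k, ∃ A : Finset M, i ∈ I → ∀ f' : M ≃[L] M, (∀ a ∈ A, f' a = f i a) →
      f' ∈ u i := by
    intro i
    by_cases hi : i ∈ I
    · let _ : TopologicalSpace M := ⊥
      have : DiscreteTopology M := ⟨rfl⟩
      obtain ⟨W, hW, hWu⟩ := isOpen_induced_iff.1 (hu i hi).1
      have hfW : (fun x => f i x) ∈ W := by
        have := (hu i hi).2
        rw [← hWu] at this
        exact this
      obtain ⟨A, v, hv, hA⟩ := isOpen_pi_iff.1 hW _ hfW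
      refine ⟨A, fun _ f' hf' => ?_⟩
      rw [← hWu]
      refine hA fun a ha => ?_
      change f' a ∈ v a
      rw [hf' a ha]
      exact (hv a ha).2
    · exact ⟨∅, fun h => absurd h hi⟩
  choose A hA using key
  refine ⟨Finset.univ.biUnion A, fun f' hf' => hI fun i hi => ?_⟩
  exact hA i hi _ fun a ha => hf' i a (Finset.mem_biUnion.2 ⟨i, Finset.mem_univ _, ha⟩)

/-- A finite set of pairs is a good approximation of a conjugation of `f` to `g` if it extends to
an automorphism and is invariant under the diagonal action of `f` and `g`. -/
def IsPartialConj {k : ℕ} (g f : Fin k → (M ≃[L] M)) (p : Finset (M × M)) : Prop :=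
  (∃ h : M ≃[L] M, ∀ z ∈ p, h z.1 = z.2) ∧ ∀ i, ∀ z ∈ p, (f i z.1, g i z.2) ∈ p

/-- Extendability of `p` to an automorphism does not involve `f`, and invariance tests only finitely
many values of `f`, each test being a clopen condition. -/
theorem isClopen_setOf_isPartialConj {k : ℕ} (g : Fin k → (M ≃[L] M)) (p : Finset (M × M)) :
    IsClopen {f | IsPartialConj g f p} := by
  by_cases hp : ∃ h : M ≃[L] M, ∀ z ∈ p, h z.1 = z.2
  · have : {f | IsPartialConj g f p} =
        ⋂ i : Fin k, ⋂ z ∈ p, {f | f i z.1 ∈ {y | (y, g i z.2) ∈ p}} := by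
      ext f
      simp only [IsPartialConj, hp, true_and, Set.mem_ofPred_eq, Set.mem_iInter]
    rw [this]
    refine isClopen_iInter_of_finite fun i => isClopen_biInter_finset fun z _ => ?_
    exact (isClopen_setOf_apply_mem z.1 {y | (y, g i z.2) ∈ p}).preimage
      (continuous_apply (A := fun _ : Fin k => (M ≃[L] M)) i)
  · have : {f | IsPartialConj g f p} = ∅ := by
      ext f
      simp only [IsPartialConj, hp, false_and, Set.mem_ofPred_eq, Set.mem_empty_iff_false]
    rw [this]
    exact isClopen_empty

/-- The tuples for which a partial conjugation `p` extends to one with `z` in its domain and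
range. -/
def extendSet {k : ℕ} (g : Fin k → (M ≃[L] M)) (p : Finset (M × M)) (z : M) :
    Set (Fin k → (M ≃[L] M)) :=
  {f | IsPartialConj g f p → ∃ q : Finset (M × M), p ⊆ q ∧ IsPartialConj g f q ∧
    (∃ y, (z, y) ∈ q) ∧ ∃ x, (x, z) ∈ q}

theorem isOpen_extendSet {k : ℕ} (g : Fin k → (M ≃[L] M)) (p : Finset (M × M)) (z : M) :
    IsOpen (extendSet g p z) := by
  have : extendSet g p z = {f | IsPartialConj g f p}ᶜ ∪
      ⋃ q : {q : Finset (M × M) // p ⊆ q ∧ (∃ y, (z, y) ∈ q) ∧ ∃ x, (x, z) ∈ q},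
        {f | IsPartialConj g f q.1} := by
    ext f
    simp only [extendSet, Set.mem_ofPred_eq, Set.mem_union, Set.mem_compl_iff, Set.mem_iUnion,
      imp_iff_not_or]
    refine or_congr Iff.rfl ⟨?_, ?_⟩
    · rintro ⟨q, h1, h2, h3, h4⟩
      exact ⟨⟨q, h1, h3, h4⟩, h2⟩
    · rintro ⟨⟨q, h1, h3, h4⟩, h2⟩
      exact ⟨q, h1, h2, h3, h4⟩
  rw [this]
  exact (isClopen_setOf_isPartialConj g p).compl.isOpen.union
    (isOpen_iUnion fun q => (isClopen_setOf_isPartialConj g q.1).isOpen)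

/-- A bijection that agrees with an automorphism on every finite set is an automorphism. -/
theorem exists_aut_of_locally (e : M ≃ M)
    (he : ∀ F : Finset M, ∃ h : M ≃[L] M, ∀ x ∈ F, h x = e x) :
    ∃ h : M ≃[L] M, ∀ x, h x = e x := by
  classical
  refine ⟨⟨e, ?_, ?_⟩, fun _ => rfl⟩
  · intro n F x
    obtain ⟨h, hh⟩ := he (insert (FirstOrder.Language.Structure.funMap F x)
      (Finset.univ.image x))
    change e _ = FirstOrder.Language.Structure.funMap F (fun i => e (x i))
    rw [← hh _ (Finset.mem_insert_self _ _)]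
    have : (fun i => e (x i)) = fun i => h (x i) := funext fun i =>
      (hh _ (Finset.mem_insert_of_mem (Finset.mem_image_of_mem x (Finset.mem_univ i)))).symm
    rw [this]
    exact h.map_fun F x
  · intro n R x
    obtain ⟨h, hh⟩ := he (Finset.univ.image x)
    change FirstOrder.Language.Structure.RelMap R (fun i => e (x i)) ↔ _
    have : (fun i => e (x i)) = fun i => h (x i) := funext fun i =>
      (hh _ (Finset.mem_image_of_mem x (Finset.mem_univ i))).symm
    rw [this]
    exact h.map_rel R x

/-- Back and forth. -/
theorem mem_diagonalConjClass_of_forall_mem_extendSet [Countable M] {k : ℕ}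
    {g f : Fin k → (M ≃[L] M)} (hf : ∀ p z, f ∈ extendSet g p z) : f ∈ diagonalConjClass g := by
  classical
  rcases isEmpty_or_nonempty M with hM | hM
  · exact ⟨1, fun i => FirstOrder.Language.Equiv.ext fun x => (hM.false x).elim⟩
  obtain ⟨enum, henum⟩ := exists_surjective_nat M
  choose! nxt h1 h2 h3 h4 using hf
  let P : ℕ → {p : Finset (M × M) // IsPartialConj g f p} := fun n => Nat.rec
    ⟨∅, ⟨1, by simp⟩, by simp⟩ (fun n p => ⟨nxt p.1 (enum n), h2 _ _ p.2⟩) n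
  have hPsucc : ∀ n, (P (n + 1)).1 = nxt (P n).1 (enum n) := fun n => rfl
  have hmono : Monotone fun n => (P n).1 := monotone_nat_of_le_succ fun n => by
    rw [hPsucc]; exact h1 _ _ (P n).2
  have hdom : ∀ x, ∃ y n, (x, y) ∈ (P n).1 := fun x => by
    obtain ⟨n, rfl⟩ := henum x
    obtain ⟨y, hy⟩ := h3 (P n).1 (enum n) (P n).2
    exact ⟨y, n + 1, hy⟩
  have hran : ∀ y, ∃ x n, (x, y) ∈ (P n).1 := fun x => by
    obtain ⟨n, rfl⟩ := henum x
    obtain ⟨y, hy⟩ := h4 (P n).1 (enum n) (P n).2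
    exact ⟨y, n + 1, hy⟩
  choose e ne he using hdom
  choose e' ne' he' using hran
  -- Two pairs always lie in a common stage, which is part of the graph of an automorphism; so the
  -- union of the stages is the graph of an injective map.
  have huniq : ∀ z w : M × M, ∀ m n, z ∈ (P m).1 → w ∈ (P n).1 → (z.1 = w.1 ↔ z.2 = w.2) := by
    intro z w m n hz hw
    obtain ⟨⟨h, hh⟩, -⟩ := (P (max m n)).2
    rw [← hh z (hmono (le_max_left m n) hz), ← hh w (hmono (le_max_right m n) hw)]
    exact h.injective.eq_iff.symm
  let E : M ≃ M := ⟨e, e', fun x => (huniq (_, _) (_, _) _ _ (he' (e x)) (he x)).2 rfl,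
    fun y => (huniq (_, _) (_, _) _ _ (he (e' y)) (he' y)).1 rfl⟩
  obtain ⟨h, hh⟩ := exists_aut_of_locally (L := L) E fun F => by
    obtain ⟨⟨h, hh⟩, -⟩ := (P (F.sup ne)).2
    exact ⟨h, fun x hx => hh _ (hmono (Finset.le_sup hx) (he x))⟩
  -- The limit `h` carries `f` to `g`, whereas the class is written with conjugates of `g`; hence
  -- the inverse.
  refine ⟨h⁻¹, fun i => FirstOrder.Language.Equiv.ext fun x => ?_⟩
  rw [inv_inv, aut_mul_apply, aut_mul_apply, hh x]
  have := (P (ne x)).2.2 i _ (he x)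
  have := (huniq _ (_, _) _ _ this (he (f i x))).1 rfl
  change g i (e x) = E (f i x) at this
  rw [← hh] at this
  change f i x = h⁻¹ (g i (e x))
  rw [this, aut_inv_apply_self]

/-- A tuple `g` of automorphisms of a countable structure with finite orbits has a comeager
diagonal conjugacy class as soon as every tuple which agrees with `g` on a finite `g`-invariant
set `D` is, on any finite set, conjugate to `g` by an automorphism fixing `D`. -/
theorem diagonalConjClass_mem_residual [Countable M] {k : ℕ} {g : Fin k → (M ≃[L] M)}
    (horb : ∀ x : M, ∃ D : Finset M, x ∈ D ∧ ∀ i, ∀ y ∈ D, g i y ∈ D)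
    (hext : ∀ (D A : Finset M) (f : Fin k → (M ≃[L] M)), (∀ i, ∀ y ∈ D, g i y ∈ D) →
      (∀ i, ∀ y ∈ D, f i y = g i y) →
      ∃ h : M ≃[L] M, (∀ y ∈ D, h y = y) ∧ ∀ i, ∀ a ∈ A, h (f i a) = g i (h a)) :
    diagonalConjClass g ∈ residual (Fin k → (M ≃[L] M)) := by
  classical
  have hsub : (⋂ z : Finset (M × M) × M, extendSet g z.1 z.2) ⊆ diagonalConjClass g :=
    fun f hf => mem_diagonalConjClass_of_forall_mem_extendSet fun p z =>
      Set.mem_iInter.1 hf (p, z)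
  refine Filter.mem_of_superset (countable_iInter_mem.2 fun z => ?_) hsub
  obtain ⟨p, z⟩ := z
  refine residual_of_dense_open (isOpen_extendSet g p z) (dense_iff_inter_open.2 ?_)
  rintro V hV ⟨f, hfV⟩
  by_cases hp : IsPartialConj g f p
  swap
  · exact ⟨f, hfV, fun h => absurd h hp⟩
  obtain ⟨A, hA⟩ := exists_finset_of_mem_open hV hfV
  obtain ⟨⟨h₀, hh₀⟩, hpf⟩ := hp
  -- Conjugating by `h₀` turns the partial conjugation `p` into the identity on its range, where the
  -- conjugated tuple agrees with `g`.
  obtain ⟨h, hhD, hhA⟩ := hext (p.image Prod.snd) (A.image h₀) (fun i => h₀ * f i * h₀⁻¹)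
    (fun i y hy => by
      obtain ⟨w, hw, rfl⟩ := Finset.mem_image.1 hy
      exact Finset.mem_image.2 ⟨_, hpf i w hw, rfl⟩)
    (fun i y hy => by
      obtain ⟨w, hw, rfl⟩ := Finset.mem_image.1 hy
      rw [← hh₀ w hw, aut_mul_apply, aut_mul_apply, aut_inv_apply_self, hh₀ w hw]
      exact hh₀ _ (hpf i w hw))
  let h' : M ≃[L] M := h * h₀
  -- The tuple `f'` is globally conjugate to `g` through `h'`, and still agrees with `f` on `A`.
  -- Thus every finite `g`-invariant set yields a partial conjugation for `f'`.
  let f' : Fin k → (M ≃[L] M) := fun i => h'⁻¹ * g i * h'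
  have hf' : ∀ i x, h' (f' i x) = g i (h' x) := fun i x => aut_apply_inv_self h' _
  have hh' : ∀ w ∈ p, h' w.1 = w.2 := fun w hw => by
    change h (h₀ w.1) = w.2
    rw [hh₀ w hw]
    exact hhD _ (Finset.mem_image_of_mem _ hw)
  refine ⟨f', hA f' fun i a ha => ?_, fun _ => ?_⟩
  · apply h'.injective
    rw [hf']
    have := hhA i (h₀ a) (Finset.mem_image_of_mem _ ha)
    rw [aut_mul_apply, aut_mul_apply, aut_inv_apply_self] at this
    exact this.symm
  · obtain ⟨D₁, hz₁, hD₁⟩ := horb z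
    obtain ⟨D₂, hz₂, hD₂⟩ := horb (h' z)
    -- The set `D₁` puts `z` into the range, and `D₂`, which contains `h' z`, puts `z` into the
    -- domain.
    let q : Finset (M × M) := (p.image Prod.snd ∪ D₁ ∪ D₂).image fun y => (h'⁻¹ y, y)
    have hq : ∀ y, y ∈ p.image Prod.snd ∪ D₁ ∪ D₂ → ∀ x, h' x = y → (x, y) ∈ q := by
      rintro y hy x rfl
      exact Finset.mem_image.2 ⟨_, hy, by rw [aut_inv_apply_self]⟩
    refine ⟨q, fun w hw => hq w.2 ?_ w.1 (hh' w hw), ⟨⟨h', ?_⟩, ?_⟩, ⟨h' z, hq _ ?_ z rfl⟩,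
      ⟨h'⁻¹ z, hq _ ?_ _ (aut_apply_inv_self h' z)⟩⟩
    · exact Finset.mem_union_left _ (Finset.mem_union_left _ (Finset.mem_image_of_mem _ hw))
    · intro w hw
      obtain ⟨y, -, rfl⟩ := Finset.mem_image.1 hw
      exact aut_apply_inv_self h' y
    · intro i w hw
      obtain ⟨y, hy, rfl⟩ := Finset.mem_image.1 hw
      refine hq _ ?_ _ ?_
      · simp only [Finset.mem_union] at hy ⊢
        rcases hy with (hy | hy) | hy
        · obtain ⟨v, hv, rfl⟩ := Finset.mem_image.1 hy
          exact Or.inl (Or.inl (Finset.mem_image.2 ⟨_, hpf i v hv, rfl⟩))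
        · exact Or.inl (Or.inr (hD₁ i y hy))
        · exact Or.inr (hD₂ i y hy)
      · rw [hf', aut_apply_inv_self]
    · exact Finset.mem_union_right _ hz₂
    · exact Finset.mem_union_left _ (Finset.mem_union_right _ hz₁)

end GenericCriterion

/-! ### The dissection of the unit interval into equal parts -/

section Interval

theorem floor_mul_lt (m : ℕ) [NeZero m] (t : UnitIco) : ⌊(m : ℝ) * t.1⌋₊ < m := by
  have hm : (0 : ℝ) < m := Nat.cast_pos.2 (NeZero.pos m)
  rw [Nat.floor_lt (mul_nonneg hm.le t.2.1)]
  exact mul_lt_of_lt_one_right hm t.2.2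

/-- The index of the interval `[j/m, (j+1)/m)` containing `t`. -/
noncomputable def ivl (m : ℕ) [NeZero m] (t : UnitIco) : Fin m :=
  ⟨⌊(m : ℝ) * t.1⌋₊, floor_mul_lt m t⟩

theorem ivl_eq_iff (m : ℕ) [NeZero m] (t : UnitIco) (j : Fin m) :
    ivl m t = j ↔ ((j : ℕ) : ℝ) ≤ m * t.1 ∧ (m : ℝ) * t.1 < (j : ℕ) + 1 := by
  rw [Fin.ext_iff]
  exact Nat.floor_eq_iff (mul_nonneg (Nat.cast_nonneg m) t.2.1)

/-- The dissection of the interval into `m` copies of itself. -/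
noncomputable def ivlEquiv (m : ℕ) [NeZero m] : UnitIco ≃ Fin m × UnitIco where
  toFun t := (ivl m t, ⟨(m : ℝ) * t.1 - (ivl m t : ℕ), by
    have := (ivl_eq_iff m t _).1 rfl
    constructor <;> linarith⟩)
  invFun p := ⟨((p.1 : ℕ) + p.2.1) / m, by
    have hm : (0 : ℝ) < m := Nat.cast_pos.2 (NeZero.pos m)
    have h1 : (0 : ℝ) ≤ p.2.1 := p.2.2.1
    have h2 : p.2.1 < (1 : ℝ) := p.2.2.2
    have h3 : ((p.1 : ℕ) : ℝ) + 1 ≤ m := by exact_mod_cast p.1.2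
    constructor
    · positivity
    · rw [div_lt_one hm]; linarith⟩
  left_inv t := by
    have hm : (m : ℝ) ≠ 0 := Nat.cast_ne_zero.2 (NeZero.ne m)
    apply Subtype.ext
    simp only
    field_simp
    ring
  right_inv p := by
    have hm : (m : ℝ) ≠ 0 := Nat.cast_ne_zero.2 (NeZero.ne m)
    have h1 : (0 : ℝ) ≤ p.2.1 := p.2.2.1
    have h2 : p.2.1 < (1 : ℝ) := p.2.2.2
    have hm' : (m : ℝ) * (((p.1 : ℕ) + p.2.1) / m) = (p.1 : ℕ) + p.2.1 := by field_simp
    refine Prod.ext ?_ (Subtype.ext ?_)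
    · rw [ivl_eq_iff]
      simp only [hm']
      constructor <;> linarith
    · have : ivl m ⟨((p.1 : ℕ) + p.2.1) / m, by
          have hm : (0 : ℝ) < m := Nat.cast_pos.2 (NeZero.pos m)
          have h3 : ((p.1 : ℕ) : ℝ) + 1 ≤ m := by exact_mod_cast p.1.2
          constructor
          · positivity
          · rw [div_lt_one hm]; linarith⟩ = p.1 := by
        rw [ivl_eq_iff]
        simp only [hm']
        constructor <;> linarith
      simp only [this, hm']
      ring

theorem ivlEquiv_fst (m : ℕ) [NeZero m] (t : UnitIco) : (ivlEquiv m t).1 = ivl m t := rfl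

/-- Refinement is self-similar: the finer index consists of the coarse index and the index of the
rescaled position inside the coarse interval. -/
theorem ivl_mul (m l : ℕ) [NeZero m] [NeZero l] (t : UnitIco) :
    ivl (m * l) t = finProdFinEquiv ((ivlEquiv m t).1, ivl l (ivlEquiv m t).2) := by
  have h := (ivl_eq_iff l (ivlEquiv m t).2 _).1 rfl
  have h2 : (ivlEquiv m t).2.1 = (m : ℝ) * t.1 - (ivl m t : ℕ) := rfl
  rw [ivl_eq_iff, finProdFinEquiv_apply_val, ivlEquiv_fst]
  rw [h2] at h
  push_cast
  constructor <;> nlinarith [h.1, h.2]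

theorem ivl_surjective (m : ℕ) [NeZero m] : Function.Surjective (ivl m) := fun j =>
  ⟨(ivlEquiv m).symm (j, ⟨0, by simp⟩), by rw [← ivlEquiv_fst, Equiv.apply_symm_apply]⟩

theorem setOf_ivl_eq (m : ℕ) [NeZero m] (j : Fin m) : {t | ivl m t = j} =
    {t : UnitIco | (((j : ℕ) / m : ℚ) : ℝ) ≤ t.1 ∧ t.1 < ((((j : ℕ) + 1) / m : ℚ) : ℝ)} := by
  have hm : (0 : ℝ) < m := Nat.cast_pos.2 (NeZero.pos m)
  ext t
  simp only [Set.mem_ofPred_eq, ivl_eq_iff]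
  push_cast
  rw [div_le_iff₀' hm, lt_div_iff₀' hm]

theorem volume_real_setOf_ivl_eq (m : ℕ) [NeZero m] (j : Fin m) :
    (volume : Measure UnitIco).real {t | ivl m t = j} = 1 / m := by
  have hm : (0 : ℝ) < m := Nat.cast_pos.2 (NeZero.pos m)
  have him : Subtype.val '' {t | ivl m t = j} =
      Set.Ico (((j : ℕ) : ℝ) / m) ((((j : ℕ) : ℝ) + 1) / m) := by
    ext x
    rw [setOf_ivl_eq]
    push_cast
    constructor
    · rintro ⟨t, ht, rfl⟩
      exact ht
    · intro hx
      have h3 : ((j : ℕ) : ℝ) + 1 ≤ m := by exact_mod_cast j.2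
      refine ⟨⟨x, le_trans (by positivity) hx.1, hx.2.trans_le ?_⟩, hx, rfl⟩
      rwa [div_le_one hm]
  change (Measure.comap Subtype.val (volume : Measure ℝ)).real _ = _
  rw [Measure.real, comap_subtype_coe_apply measurableSet_Ico, him, Real.volume_Ico,
    ENNReal.toReal_ofReal]
  · field_simp
    ring
  · rw [sub_nonneg]
    gcongr
    linarith

theorem measurable_ivl (m : ℕ) [NeZero m] : Measurable (ivl m) := by
  refine measurable_to_countable' fun j => ?_
  change MeasurableSet {t | ivl m t = j}
  rw [setOf_ivl_eq]
  exact (measurableSet_le measurable_const measurable_subtype_coe).inter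
    (measurableSet_lt measurable_subtype_coe measurable_const)

theorem setOf_ivl_eq_mem (m : ℕ) [NeZero m] (j : Fin m) : {t | ivl m t = j} ∈ ratAlg :=
  BooleanSubalgebra.subset_closure ⟨_, _, setOf_ivl_eq m j⟩

/-- Membership in a set of `ratAlg` is decided by `ivl m` for some `m`. -/
theorem exists_ivl_of_mem_ratAlg {b : Set UnitIco} (hb : b ∈ ratAlg) :
    ∃ (m : ℕ) (_ : NeZero m), ∀ t t', ivl m t = ivl m t' → (t ∈ b ↔ t' ∈ b) := by
  induction hb using BooleanSubalgebra.closure_bot_sup_induction with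
  | mem x hx =>
    obtain ⟨p, q, rfl⟩ := hx
    -- The endpoint `r` is an integer multiple of the step `1 / (r.den * l)`, so no grid interval
    -- crosses it. Integrality of `r.num * l` permits replacing `r.den * l * t` by its floor.
    have key : ∀ (r : ℚ) (l : ℕ) [NeZero r.den] [NeZero l] (t t' : UnitIco),
        ivl (r.den * l) t = ivl (r.den * l) t' → (r : ℝ) ≤ t.1 → (r : ℝ) ≤ t'.1 := by
      intro r l _ _ t t' h hr
      have hd : (0 : ℝ) < r.den := Nat.cast_pos.2 r.den_pos
      have hl : (0 : ℝ) < l := Nat.cast_pos.2 (NeZero.pos l)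
      have hrq : (r : ℝ) = r.num / r.den := by exact_mod_cast (Rat.num_div_den r).symm
      rw [hrq, div_le_iff₀' hd] at hr ⊢
      have h1 := (ivl_eq_iff (r.den * l) t _).1 rfl
      have h2 := (ivl_eq_iff (r.den * l) t' _).1 rfl
      rw [← h] at h2
      push_cast at h1 h2
      have h3 : (r.num * l : ℤ) < ((ivl (r.den * l) t : ℕ) : ℤ) + 1 := by
        have : (r.num * l : ℝ) < ((ivl (r.den * l) t : ℕ) : ℝ) + 1 := by nlinarith
        exact_mod_cast this
      have h4 : (r.num * l : ℝ) ≤ ((ivl (r.den * l) t : ℕ) : ℝ) := by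
        exact_mod_cast Int.lt_add_one_iff.1 h3
      have h5 : (r.num * l : ℝ) ≤ (r.den * t'.1) * l := by linarith [h2.1]
      exact le_of_mul_le_mul_right h5 hl
    have key' : ∀ (r : ℚ) (l : ℕ) [NeZero r.den] [NeZero l] (t t' : UnitIco),
        ivl (r.den * l) t = ivl (r.den * l) t' → ((r : ℝ) ≤ t.1 ↔ (r : ℝ) ≤ t'.1) :=
      fun r l _ _ t t' h => ⟨key r l t t' h, key r l t' t h.symm⟩
    have : NeZero p.den := ⟨p.den_nz⟩
    have : NeZero q.den := ⟨q.den_nz⟩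
    refine ⟨p.den * q.den, inferInstance, fun t t' h => ?_⟩
    simp only [Set.mem_ofPred_eq]
    refine and_congr (key' p q.den t t' h) ?_
    rw [← not_le, ← not_le]
    refine not_congr (key' q p.den t t' ?_)
    simp only [Fin.ext_iff] at h ⊢
    simpa only [ivl, mul_comm p.den q.den] using h
  | bot => exact ⟨1, inferInstance, fun _ _ _ => Iff.rfl⟩
  | sup x hx y hy h1 h2 =>
    obtain ⟨m, _, hm⟩ := h1
    obtain ⟨l, _, hl⟩ := h2
    refine ⟨m * l, inferInstance, fun t t' h => or_congr (hm t t' ?_) (hl t t' ?_)⟩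
    · rw [ivl_mul, ivl_mul, finProdFinEquiv.injective.eq_iff] at h
      exact congrArg Prod.fst h
    · have h' : ivl (l * m) t = ivl (l * m) t' := by
        simp only [Fin.ext_iff] at h ⊢
        simpa only [ivl, mul_comm m l] using h
      rw [ivl_mul, ivl_mul, finProdFinEquiv.injective.eq_iff] at h'
      exact congrArg Prod.fst h'
  | compl x hx h =>
    obtain ⟨m, _, hm⟩ := h
    exact ⟨m, inferInstance, fun t t' h => not_congr (hm t t' h)⟩

theorem ivl_eq_of_dvd {m m' : ℕ} [NeZero m] [NeZero m'] (h : m ∣ m') {t t' : UnitIco}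
    (ht : ivl m' t = ivl m' t') : ivl m t = ivl m t' := by
  obtain ⟨l, rfl⟩ := h
  have : NeZero l := ⟨right_ne_zero_of_mul (NeZero.ne (m * l))⟩
  rw [ivl_mul, ivl_mul, finProdFinEquiv.injective.eq_iff] at ht
  exact congrArg Prod.fst ht

end Interval

/-! ### Cells -/

section Cells

variable {G : Type} [Group G] [TopologicalSpace G] [IsTopologicalGroup G] [CompactSpace G]

instance finite_quotient_openNormalSubgroup (U : OpenNormalSubgroup G) :
    Finite (G ⧸ U.toSubgroup) :=
  Subgroup.quotient_finite_of_isOpen _ U.isOpen'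

/-- The map sending a point of `G × [0,1)` to its cell, for the partition of `G` into cosets
of `U` and of `[0,1)` into `m` intervals. -/
noncomputable def cellMap (U : OpenNormalSubgroup G) (m : ℕ) [NeZero m] (z : G × UnitIco) :
    (G ⧸ U.toSubgroup) × Fin m :=
  (QuotientGroup.mk z.1, ivl m z.2)

theorem cellMap_surjective (U : OpenNormalSubgroup G) (m : ℕ) [NeZero m] :
    Function.Surjective (cellMap U m) := by
  rintro ⟨q, j⟩
  obtain ⟨z, rfl⟩ := QuotientGroup.mk_surjective q
  obtain ⟨t, rfl⟩ := ivl_surjective m j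
  exact ⟨(z, t), rfl⟩

/-- A set is a union of cells. -/
def IsLevel (U : OpenNormalSubgroup G) (m : ℕ) [NeZero m] (a : Set (G × UnitIco)) : Prop :=
  ∀ z z', cellMap U m z = cellMap U m z' → (z ∈ a ↔ z' ∈ a)

theorem isLevel_preimage (U : OpenNormalSubgroup G) (m : ℕ) [NeZero m]
    (S : Set ((G ⧸ U.toSubgroup) × Fin m)) : IsLevel U m (cellMap U m ⁻¹' S) := fun z z' h => by
  rw [Set.mem_preimage, Set.mem_preimage, h]

theorem IsLevel.exists_eq {U : OpenNormalSubgroup G} {m : ℕ} [NeZero m] {a : Set (G × UnitIco)}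
    (h : IsLevel U m a) : ∃ S, a = cellMap U m ⁻¹' S := by
  refine ⟨cellMap U m '' a, Set.Subset.antisymm (Set.subset_preimage_image _ _) ?_⟩
  rintro z ⟨z', hz', hzz'⟩
  exact (h _ _ hzz').1 hz'

theorem cellMap_eq_of_le {U U' : OpenNormalSubgroup G} {m m' : ℕ} [NeZero m] [NeZero m']
    (hU : U' ≤ U) (hm : m ∣ m') {z z' : G × UnitIco} (h : cellMap U' m' z = cellMap U' m' z') :
    cellMap U m z = cellMap U m z' := by
  refine Prod.ext ?_ (ivl_eq_of_dvd hm (congrArg Prod.snd h))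
  have h1 := QuotientGroup.eq.1 (congrArg Prod.fst h)
  exact QuotientGroup.eq.2 (hU h1)

theorem IsLevel.mono {U U' : OpenNormalSubgroup G} {m m' : ℕ} [NeZero m] [NeZero m']
    {a : Set (G × UnitIco)} (h : IsLevel U m a) (hU : U' ≤ U) (hm : m ∣ m') : IsLevel U' m' a :=
  fun z z' hz => h z z' (cellMap_eq_of_le hU hm hz)

theorem isClopen_setOf_mk_eq (U : OpenNormalSubgroup G) (q : G ⧸ U.toSubgroup) :
    IsClopen {z : G | QuotientGroup.mk z = q} := by
  have : DiscreteTopology (G ⧸ U.toSubgroup) := QuotientGroup.discreteTopology U.isOpen'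
  exact (isClopen_discrete {q}).preimage QuotientGroup.continuous_mk

theorem preimage_cellMap_singleton (U : OpenNormalSubgroup G) (m : ℕ) [NeZero m]
    (x : (G ⧸ U.toSubgroup) × Fin m) : cellMap U m ⁻¹' {x} =
      {z : G | QuotientGroup.mk z = x.1} ×ˢ {t | ivl m t = x.2} := by
  ext z
  simp [cellMap, Prod.ext_iff]

theorem IsLevel.mem_tensor {U : OpenNormalSubgroup G} {m : ℕ} [NeZero m] {a : Set (G × UnitIco)}
    (h : IsLevel U m a) : a ∈ tensor (clop G) ratAlg := by
  obtain ⟨S, rfl⟩ := h.exists_eq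
  induction S, S.toFinite using Set.Finite.induction_on with
  | empty => exact BooleanSubalgebra.bot_mem
  | @insert x S _ _ ih =>
    have : cellMap U m ⁻¹' insert x S = cellMap U m ⁻¹' {x} ⊔ cellMap U m ⁻¹' S := by
      rw [Set.insert_eq, Set.preimage_union]
      rfl
    rw [this]
    refine BooleanSubalgebra.sup_mem (BooleanSubalgebra.subset_closure ?_)
      (ih (isLevel_preimage U m S))
    exact ⟨_, isClopen_setOf_mk_eq U x.1, _, setOf_ivl_eq_mem m x.2,
      preimage_cellMap_singleton U m x⟩

/-! ### Members of the algebra as unions of cells, for a profinite group -/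

section TotallyDisconnected

variable [TotallyDisconnectedSpace G]

/-- By compactness a clopen set is stable under right multiplication by a neighbourhood of `1`, and
in a profinite group such a neighbourhood contains an open normal subgroup. -/
theorem exists_openNormalSubgroup_of_isClopen {c : Set G} (hc : IsClopen c) :
    ∃ U : OpenNormalSubgroup G, ∀ z z' : G,
      (QuotientGroup.mk z : G ⧸ U.toSubgroup) = QuotientGroup.mk z' → (z ∈ c ↔ z' ∈ c) := by
  obtain ⟨T, hT, hcT⟩ := IsTopologicalGroup.exist_mul_closure_nhds hc
  obtain ⟨V, hVT, hV, h1⟩ := mem_nhds_iff.1 hT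
  obtain ⟨U, hU⟩ := ProfiniteGrp.exist_openNormalSubgroup_sub_open_nhds_of_one hV h1
  have key : ∀ z z' : G, (QuotientGroup.mk z : G ⧸ U.toSubgroup) = QuotientGroup.mk z' →
      z ∈ c → z' ∈ c := by
    intro z z' h hz
    have h2 : z⁻¹ * z' ∈ T := hVT (hU (QuotientGroup.eq.1 h))
    have := hcT (Set.mul_mem_mul hz h2)
    rwa [mul_inv_cancel_left] at this
  exact ⟨U, fun z z' h => ⟨key z z' h, key z' z h.symm⟩⟩

theorem exists_isLevel {a : Set (G × UnitIco)} (ha : a ∈ tensor (clop G) ratAlg) :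
    ∃ (U : OpenNormalSubgroup G) (m : ℕ) (_ : NeZero m), IsLevel U m a := by
  induction ha using BooleanSubalgebra.closure_bot_sup_induction with
  | mem x hx =>
    obtain ⟨c, hc, b, hb, rfl⟩ := hx
    obtain ⟨U, hU⟩ := exists_openNormalSubgroup_of_isClopen hc
    obtain ⟨m, _, hm⟩ := exists_ivl_of_mem_ratAlg hb
    exact ⟨U, m, inferInstance, fun z z' h => and_congr (hU _ _ (congrArg Prod.fst h))
      (hm _ _ (congrArg Prod.snd h))⟩
  | bot =>
    obtain ⟨U, -⟩ := exists_openNormalSubgroup_of_isClopen (G := G) isClopen_univ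
    exact ⟨U, 1, inferInstance, fun _ _ _ => Iff.rfl⟩
  | sup x hx y hy h1 h2 =>
    obtain ⟨U, m, _, hx⟩ := h1
    obtain ⟨V, l, _, hy⟩ := h2
    exact ⟨U ⊓ V, m * l, inferInstance, fun z z' h =>
      or_congr (hx.mono inf_le_left (dvd_mul_right m l) z z' h)
        (hy.mono inf_le_right (dvd_mul_left l m) z z' h)⟩
  | compl x hx h =>
    obtain ⟨U, m, _, hx⟩ := h
    exact ⟨U, m, inferInstance, fun z z' h => not_congr (hx z z' h)⟩

/-- Finitely many elements of the algebra are unions of cells of a common partition. -/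
theorem exists_isLevel_of_finite {s : Set (Set (G × UnitIco))} (hs : s.Finite)
    (h : ∀ a ∈ s, a ∈ tensor (clop G) ratAlg) :
    ∃ (U : OpenNormalSubgroup G) (m : ℕ) (_ : NeZero m), ∀ a ∈ s, IsLevel U m a := by
  induction s, hs using Set.Finite.induction_on with
  | empty =>
    obtain ⟨U, m, hm, -⟩ := exists_isLevel (G := G) (BooleanSubalgebra.bot_mem)
    exact ⟨U, m, hm, by simp⟩
  | @insert x S _ _ ih =>
    obtain ⟨U, m, _, hU⟩ := ih fun a ha => h a (Set.mem_insert_of_mem _ ha)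
    obtain ⟨V, l, _, hV⟩ := exists_isLevel (h x (Set.mem_insert _ _))
    refine ⟨U ⊓ V, m * l, inferInstance, ?_⟩
    rintro a (rfl | ha)
    · exact hV.mono inf_le_right (dvd_mul_left l m)
    · exact (hU a ha).mono inf_le_left (dvd_mul_right m l)

end TotallyDisconnected

/-! ### The measure of a union of cells -/

section Measure

variable [MeasureSpace G] [BorelSpace G] [IsProbabilityMeasure (volume : Measure G)]
  [(volume : Measure G).IsMulLeftInvariant]

theorem measurableSet_preimage_cellMap (U : OpenNormalSubgroup G) (m : ℕ) [NeZero m]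
    (S : Set ((G ⧸ U.toSubgroup) × Fin m)) : MeasurableSet (cellMap U m ⁻¹' S) := by
  have : cellMap U m ⁻¹' S = ⋃ x ∈ S, cellMap U m ⁻¹' {x} := by
    rw [← Set.preimage_iUnion₂, Set.biUnion_of_singleton]
  rw [this]
  refine MeasurableSet.biUnion S.to_countable fun x _ => ?_
  rw [preimage_cellMap_singleton]
  exact (isClopen_setOf_mk_eq U x.1).isOpen.measurableSet.prod
    (measurable_ivl m (measurableSet_singleton x.2))

theorem IsLevel.measurableSet {U : OpenNormalSubgroup G} {m : ℕ} [NeZero m]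
    {a : Set (G × UnitIco)} (h : IsLevel U m a) : MeasurableSet a := by
  obtain ⟨S, rfl⟩ := h.exists_eq
  exact measurableSet_preimage_cellMap U m S

/-- The finitely many cosets partition the group and are left translates of one another. -/
theorem volume_real_setOf_mk_eq (U : OpenNormalSubgroup G) (q : G ⧸ U.toSubgroup) :
    (volume : Measure G).real {z : G | QuotientGroup.mk z = q} =
      1 / Nat.card (G ⧸ U.toSubgroup) := by
  have h1 : ∀ q : G ⧸ U.toSubgroup, (volume : Measure G).real {z : G | QuotientGroup.mk z = q} =
      (volume : Measure G).real {z : G | (QuotientGroup.mk z : G ⧸ U.toSubgroup) = 1} := by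
    intro q
    obtain ⟨w, rfl⟩ := QuotientGroup.mk_surjective q
    rw [Measure.real, Measure.real, ← measure_preimage_mul volume w]
    congr 2
    ext z
    rw [Set.mem_preimage, Set.mem_ofPred_eq, Set.mem_ofPred_eq, QuotientGroup.mk_mul,
      mul_eq_left]
  have := Fintype.ofFinite (G ⧸ U.toSubgroup)
  have h2 := sum_measureReal_preimage_singleton (μ := (volume : Measure G))
    (f := (QuotientGroup.mk : G → G ⧸ U.toSubgroup)) Finset.univ
    (fun q _ => (isClopen_setOf_mk_eq U q).isOpen.measurableSet)
  have h3 : ∀ q : G ⧸ U.toSubgroup, (volume : Measure G).real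
    ((QuotientGroup.mk : G → G ⧸ U.toSubgroup) ⁻¹' {q}) = _ := h1
  rw [Finset.sum_congr rfl fun q _ => h3 q, Finset.sum_const, Finset.coe_univ, Set.preimage_univ,
    probReal_univ, nsmul_eq_mul, Finset.card_univ, ← Nat.card_eq_fintype_card] at h2
  rw [h1 q]
  exact eq_one_div_of_mul_eq_one_right h2

/-- All cells of a level have equal measure, so measuring amounts to counting. Equalities of
measures become equalities of cardinalities, which permutations can realize. -/
theorem volume_real_preimage_cellMap (U : OpenNormalSubgroup G) (m : ℕ) [NeZero m]
    (S : Set ((G ⧸ U.toSubgroup) × Fin m)) :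
    (volume : Measure (G × UnitIco)).real (cellMap U m ⁻¹' S) =
      Nat.card S / (Nat.card (G ⧸ U.toSubgroup) * m) := by
  classical
  have := Fintype.ofFinite (G ⧸ U.toSubgroup)
  have h2 := sum_measureReal_preimage_singleton (μ := (volume : Measure (G × UnitIco)))
    (f := cellMap U m) S.toFinset (fun x _ => measurableSet_preimage_cellMap U m {x})
  rw [Set.coe_toFinset] at h2
  rw [← h2]
  have h3 : ∀ x, (volume : Measure (G × UnitIco)).real (cellMap U m ⁻¹' {x}) =
      1 / (Nat.card (G ⧸ U.toSubgroup) * m) := by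
    intro x
    rw [preimage_cellMap_singleton]
    change ((volume : Measure G).prod (volume : Measure UnitIco)).real _ = _
    rw [measureReal_prod_prod, volume_real_setOf_mk_eq, volume_real_setOf_ivl_eq]
    field_simp
  rw [Finset.sum_congr rfl fun x _ => h3 x, Finset.sum_const, Set.toFinset_card,
    ← Nat.card_eq_fintype_card, nsmul_eq_mul, mul_one_div]

end Measure

end Cells

/-! ### Homogeneity -/

section Homogeneity

theorem exists_perm_of_card_fiber_eq {X Y : Type} [Finite X] (τ τ' : X → Y)
    (h : ∀ y, Nat.card {x | τ x = y} = Nat.card {x | τ' x = y}) :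
    ∃ σ : Equiv.Perm X, ∀ x, τ' (σ x) = τ x := by
  have e : ∀ y, Nonempty ({x // τ x = y} ≃ {x // τ' x = y}) := fun y =>
    ⟨(Finite.equivFin _).trans ((finCongr (h y)).trans (Finite.equivFin _).symm)⟩
  exact ⟨Equiv.ofFiberEquiv fun y => (e y).some, Equiv.ofFiberEquiv_map _⟩

variable {G : Type} [Group G] [TopologicalSpace G] [IsTopologicalGroup G] [CompactSpace G]

/-- A group is the product of the cosets of a subgroup and the subgroup. -/
noncomputable def cosetEquiv (U : Subgroup G) : G ≃ (G ⧸ U) × U where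
  toFun z := (QuotientGroup.mk z, ⟨(QuotientGroup.mk z : G ⧸ U).out⁻¹ * z,
    QuotientGroup.eq.1 (Quotient.out_eq _)⟩)
  invFun p := p.1.out * p.2
  left_inv z := mul_inv_cancel_left _ _
  right_inv p := by
    have h : (QuotientGroup.mk (p.1.out * (p.2 : G)) : G ⧸ U) = p.1 := by
      rw [QuotientGroup.mk_mul_of_mem _ p.2.2]
      exact Quotient.out_eq _
    refine Prod.ext h (Subtype.ext ?_)
    simp only [h, inv_mul_cancel_left]

/-- All cells are isomorphic: the space is the product of the set of cells and a fixed cell. -/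
noncomputable def cellEquiv (U : OpenNormalSubgroup G) (m : ℕ) [NeZero m] :
    G × UnitIco ≃ ((G ⧸ U.toSubgroup) × Fin m) × (U.toSubgroup × UnitIco) :=
  ((cosetEquiv U.toSubgroup).prodCongr (ivlEquiv m)).trans (Equiv.prodProdProdComm _ _ _ _)

theorem cellEquiv_fst (U : OpenNormalSubgroup G) (m : ℕ) [NeZero m] (z : G × UnitIco) :
    (cellEquiv U m z).1 = cellMap U m z := rfl

/-- Finer cells can be read off in the coordinates of `cellEquiv`. Two points of one coset of `U`
use the same representative, which cancels in the quotient of their `U`-coordinates. The last two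
conditions do not mention the coarse cell, which is why permuting coarse cells preserves every finer
partition of this form. -/
theorem cellMap_eq_iff_cellEquiv {U U' : OpenNormalSubgroup G} (hU : U' ≤ U) (m l : ℕ) [NeZero m]
    [NeZero l] (z z' : G × UnitIco) : cellMap U' (m * l) z = cellMap U' (m * l) z' ↔
      (cellEquiv U m z).1 = (cellEquiv U m z').1 ∧
      ((cellEquiv U m z).2.1 : G)⁻¹ * (cellEquiv U m z').2.1 ∈ U'.toSubgroup ∧
      ivl l (cellEquiv U m z).2.2 = ivl l (cellEquiv U m z').2.2 := by
  have h1 : cellMap U' (m * l) z = cellMap U' (m * l) z' ↔ z.1⁻¹ * z'.1 ∈ U'.toSubgroup ∧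
      (ivl m z.2 = ivl m z'.2 ∧ ivl l (cellEquiv U m z).2.2 = ivl l (cellEquiv U m z').2.2) := by
    rw [cellMap, cellMap, Prod.mk.injEq, QuotientGroup.eq, ivl_mul, ivl_mul,
      finProdFinEquiv.injective.eq_iff, Prod.mk.injEq]
    rfl
  have h2 : (cellEquiv U m z).1 = (cellEquiv U m z').1 ↔
      (QuotientGroup.mk z.1 : G ⧸ U.toSubgroup) = QuotientGroup.mk z'.1 ∧
        ivl m z.2 = ivl m z'.2 := by
    rw [cellEquiv_fst, cellEquiv_fst, cellMap, cellMap, Prod.mk.injEq]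
  have h3 : (QuotientGroup.mk z.1 : G ⧸ U.toSubgroup) = QuotientGroup.mk z'.1 →
      ((cellEquiv U m z).2.1 : G)⁻¹ * (cellEquiv U m z').2.1 = z.1⁻¹ * z'.1 := by
    intro h
    change ((QuotientGroup.mk z.1 : G ⧸ U.toSubgroup).out⁻¹ * z.1)⁻¹ *
      ((QuotientGroup.mk z'.1 : G ⧸ U.toSubgroup).out⁻¹ * z'.1) = _
    rw [h]
    group
  rw [h1, h2]
  constructor
  · rintro ⟨ha, hb, hc⟩
    have hq : (QuotientGroup.mk z.1 : G ⧸ U.toSubgroup) = QuotientGroup.mk z'.1 :=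
      QuotientGroup.eq.2 (hU ha)
    exact ⟨⟨hq, hb⟩, (h3 hq).symm ▸ ha, hc⟩
  · rintro ⟨⟨hq, hb⟩, ha, hc⟩
    exact ⟨h3 hq ▸ ha, hb, hc⟩

/-- The bijection of the space which permutes the cells according to `σ`. -/
noncomputable def permCells (U : OpenNormalSubgroup G) (m : ℕ) [NeZero m]
    (σ : Equiv.Perm ((G ⧸ U.toSubgroup) × Fin m)) : G × UnitIco ≃ G × UnitIco :=
  (cellEquiv U m).trans ((σ.prodCongr (Equiv.refl _)).trans (cellEquiv U m).symm)

theorem cellEquiv_permCells (U : OpenNormalSubgroup G) (m : ℕ) [NeZero m]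
    (σ : Equiv.Perm ((G ⧸ U.toSubgroup) × Fin m)) (z : G × UnitIco) :
    cellEquiv U m (permCells U m σ z) = (σ (cellEquiv U m z).1, (cellEquiv U m z).2) := by
  simp only [permCells, Equiv.trans_apply, Equiv.apply_symm_apply]
  rfl

theorem cellMap_permCells (U : OpenNormalSubgroup G) (m : ℕ) [NeZero m]
    (σ : Equiv.Perm ((G ⧸ U.toSubgroup) × Fin m)) (z : G × UnitIco) :
    cellMap U m (permCells U m σ z) = σ (cellMap U m z) := by
  rw [← cellEquiv_fst, cellEquiv_permCells, cellEquiv_fst]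

/-- Two points are in the same cell, for each partition refining a given one, if and only if
their images are. -/
def PreservesCells (U : OpenNormalSubgroup G) (m : ℕ) [NeZero m]
    (e : G × UnitIco ≃ G × UnitIco) : Prop :=
  ∀ U' : OpenNormalSubgroup G, U' ≤ U → ∀ (l : ℕ) [NeZero l] (z z' : G × UnitIco),
    cellMap U' (m * l) (e z) = cellMap U' (m * l) (e z') ↔
      cellMap U' (m * l) z = cellMap U' (m * l) z'

theorem preservesCells_permCells (U : OpenNormalSubgroup G) (m : ℕ) [NeZero m]
    (σ : Equiv.Perm ((G ⧸ U.toSubgroup) × Fin m)) : PreservesCells U m (permCells U m σ) := by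
  intro U' hU l _ z z'
  rw [cellMap_eq_iff_cellEquiv hU, cellMap_eq_iff_cellEquiv hU, cellEquiv_permCells,
    cellEquiv_permCells, σ.injective.eq_iff]

theorem PreservesCells.symm {U : OpenNormalSubgroup G} {m : ℕ} [NeZero m]
    {e : G × UnitIco ≃ G × UnitIco} (he : PreservesCells U m e) : PreservesCells U m e.symm := by
  intro U' hU l _ z z'
  rw [← he U' hU l, Equiv.apply_symm_apply, Equiv.apply_symm_apply]

variable [TotallyDisconnectedSpace G]

theorem PreservesCells.image_mem {U : OpenNormalSubgroup G} {m : ℕ} [NeZero m]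
    {e : G × UnitIco ≃ G × UnitIco} (he : PreservesCells U m e) :
    ∀ a ∈ tensor (clop G) ratAlg, e '' a ∈ tensor (clop G) ratAlg := by
  intro a ha
  obtain ⟨V, l, _, h⟩ := exists_isLevel ha
  have h' : IsLevel (U ⊓ V) (m * l) a := h.mono inf_le_right (dvd_mul_left l m)
  refine IsLevel.mem_tensor (U := U ⊓ V) (m := m * l) fun z z' hz => ?_
  rw [Equiv.image_eq_preimage_symm]
  exact h' _ _ ((he.symm (U ⊓ V) inf_le_left l z z').2 hz)

variable [MeasureSpace G] [BorelSpace G] [IsProbabilityMeasure (volume : Measure G)]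
  [(volume : Measure G).IsMulLeftInvariant]

/-- At a level fine enough for both `e` and `a`, the bijection induces an injection on cells, so the
number of cells in `a` is unchanged. -/
theorem PreservesCells.volume_real_image {U : OpenNormalSubgroup G} {m : ℕ} [NeZero m]
    {e : G × UnitIco ≃ G × UnitIco} (he : PreservesCells U m e) :
    ∀ a ∈ tensor (clop G) ratAlg, (volume : Measure (G × UnitIco)).real (e '' a) =
      (volume : Measure (G × UnitIco)).real a := by
  intro a ha
  obtain ⟨V, l, _, h⟩ := exists_isLevel ha
  obtain ⟨S, hS⟩ := (h.mono (inf_le_right : U ⊓ V ≤ V) (dvd_mul_left l m)).exists_eq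
  have hP := he (U ⊓ V) inf_le_left l
  obtain ⟨r, hr⟩ := (cellMap_surjective (U ⊓ V) (m * l)).hasRightInverse
  have hinj : Function.Injective fun x => cellMap (U ⊓ V) (m * l) (e (r x)) := fun x y hxy => by
    rw [← hr x, ← hr y]
    exact (hP _ _).1 hxy
  have him : e '' a =
      cellMap (U ⊓ V) (m * l) ⁻¹' ((fun x => cellMap (U ⊓ V) (m * l) (e (r x))) '' S) := by
    subst hS
    ext z
    constructor
    · rintro ⟨w, hw, rfl⟩
      exact ⟨_, hw, (hP _ _).2 (hr _)⟩
    · rintro ⟨x, hx, hxz⟩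
      refine ⟨e.symm z, ?_, e.apply_symm_apply z⟩
      have : cellMap (U ⊓ V) (m * l) (e (r x)) = cellMap (U ⊓ V) (m * l) (e (e.symm z)) := by
        rw [e.apply_symm_apply]; exact hxz
      rw [Set.mem_preimage, ← (hP _ _).1 this, hr]
      exact hx
  rw [him, hS, volume_real_preimage_cellMap, volume_real_preimage_cellMap,
    Nat.card_image_of_injective hinj]

/-- A bijection preserving cells induces an automorphism. -/
noncomputable def PreservesCells.aut {U : OpenNormalSubgroup G} {m : ℕ} [NeZero m]
    {e : G × UnitIco ≃ G × UnitIco} (he : PreservesCells U m e) :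
    tensor (clop G) ratAlg ≃[mbaLang] tensor (clop G) ratAlg :=
  imageAut _ e he.image_mem he.symm.image_mem he.volume_real_image

theorem PreservesCells.coe_aut {U : OpenNormalSubgroup G} {m : ℕ} [NeZero m]
    {e : G × UnitIco ≃ G × UnitIco} (he : PreservesCells U m e) (a : tensor (clop G) ratAlg) :
    (he.aut a : Set (G × UnitIco)) = e '' a := rfl

/-- Two maps into a finite set with fibres in the algebra and the same distribution are conjugate
by an automorphism. -/
theorem exists_aut_of_distribution_eq {X : Type} [Finite X] {φ φ' : G × UnitIco → X}
    (hφ : ∀ x, φ ⁻¹' {x} ∈ tensor (clop G) ratAlg) (hφ' : ∀ x, φ' ⁻¹' {x} ∈ tensor (clop G) ratAlg)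
    (h : ∀ x, (volume : Measure (G × UnitIco)).real (φ ⁻¹' {x}) =
      (volume : Measure (G × UnitIco)).real (φ' ⁻¹' {x})) :
    ∃ f : tensor (clop G) ratAlg ≃[mbaLang] tensor (clop G) ratAlg,
      ∀ (a : tensor (clop G) ratAlg) (S : Set X), (a : Set (G × UnitIco)) = φ ⁻¹' S →
        (f a : Set (G × UnitIco)) = φ' ⁻¹' S := by
  obtain ⟨U, m, _, hL⟩ := exists_isLevel_of_finite
    ((Set.finite_range fun x => φ ⁻¹' {x}).union (Set.finite_range fun x => φ' ⁻¹' {x})) (by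
      rintro a (⟨x, rfl⟩ | ⟨x, rfl⟩)
      exacts [hφ x, hφ' x])
  obtain ⟨r, hr⟩ := (cellMap_surjective U m).hasRightInverse
  have h1 : ∀ z, φ (r (cellMap U m z)) = φ z := fun z =>
    ((hL _ (Or.inl ⟨φ z, rfl⟩)) _ _ (hr (cellMap U m z))).2 rfl
  have h2 : ∀ z, φ' (r (cellMap U m z)) = φ' z := fun z =>
    ((hL _ (Or.inr ⟨φ' z, rfl⟩)) _ _ (hr (cellMap U m z))).2 rfl
  -- Both maps factor through the cells; equal measures mean that each value is taken on equally
  -- many cells.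
  obtain ⟨σ, hσ⟩ := exists_perm_of_card_fiber_eq (fun x => φ (r x)) (fun x => φ' (r x))
    fun x => by
      have e1 : φ ⁻¹' {x} = cellMap U m ⁻¹' {y | φ (r y) = x} := by
        ext z
        rw [Set.mem_preimage, Set.mem_preimage, Set.mem_ofPred_eq, h1]
        rfl
      have e2 : φ' ⁻¹' {x} = cellMap U m ⁻¹' {y | φ' (r y) = x} := by
        ext z
        rw [Set.mem_preimage, Set.mem_preimage, Set.mem_ofPred_eq, h2]
        rfl
      have h3 := h x
      rw [e1, e2, volume_real_preimage_cellMap, volume_real_preimage_cellMap] at h3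
      have hpos : (0 : ℝ) < Nat.card (G ⧸ U.toSubgroup) * m :=
        mul_pos (Nat.cast_pos.2 Nat.card_pos) (Nat.cast_pos.2 (NeZero.pos m))
      exact_mod_cast (div_left_inj' hpos.ne').1 h3
  refine ⟨(preservesCells_permCells U m σ).aut, fun a S ha => ?_⟩
  rw [PreservesCells.coe_aut, ha]
  have h3 : ∀ z, φ' (permCells U m σ z) = φ z := fun z => by
    rw [← h1 z, ← h2, cellMap_permCells]
    exact hσ _
  ext z
  constructor
  · rintro ⟨w, hw, rfl⟩
    rw [Set.mem_preimage, h3]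
    exact hw
  · intro hz
    refine ⟨(permCells U m σ).symm z, ?_, Equiv.apply_symm_apply _ z⟩
    rw [Set.mem_preimage, ← h3, Equiv.apply_symm_apply]
    exact hz

end Homogeneity

/-! ### The Fraïssé limit -/

section FraisseLimit

open FirstOrder.Language FirstOrder.Language.Structure

/-- The algebra generated by the rectangles with a clopen and a rational side. -/
abbrev rectAlg (G : Type) [TopologicalSpace G] : BooleanSubalgebra (Set (G × UnitIco)) :=
  tensor (clop G) ratAlg

/-! ### Boolean terms and their values under embeddings -/

section Operations

variable {Ω : Type} [MeasureSpace Ω] {N : BooleanSubalgebra (Set Ω)} {M : Type}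
  [mbaLang.Structure M]

/-- The intersection of a structure in the language of measured Boolean algebras. -/
def interOp (x y : M) : M := funMap (show mbaLang.Functions 2 from MBAFun.inter) ![x, y]

/-- The symmetric difference of a structure in the language of measured Boolean algebras. -/
def symmDiffOp (x y : M) : M := funMap (show mbaLang.Functions 2 from MBAFun.symmDiff) ![x, y]

/-- The union of a structure in the language of measured Boolean algebras. -/
def unionOp (x y : M) : M := funMap (show mbaLang.Functions 2 from MBAFun.union) ![x, y]

/-- The least element of a structure in the language of measured Boolean algebras. -/
def zeroOp (M : Type) [mbaLang.Structure M] : M :=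
  funMap (show mbaLang.Functions 0 from MBAFun.zero) ![]

/-- The largest element of a structure in the language of measured Boolean algebras. -/
def oneOp (M : Type) [mbaLang.Structure M] : M :=
  funMap (show mbaLang.Functions 0 from MBAFun.one) ![]

theorem coe_interOp (e : M ↪[mbaLang] N) (x y : M) : (e (interOp x y) : Set Ω) =
    (e x : Set Ω) ∩ (e y : Set Ω) :=
  congrArg Subtype.val (e.map_fun _ _)

theorem coe_unionOp (e : M ↪[mbaLang] N) (x y : M) : (e (unionOp x y) : Set Ω) =
    (e x : Set Ω) ∪ (e y : Set Ω) :=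
  congrArg Subtype.val (e.map_fun _ _)

theorem coe_zeroOp (e : M ↪[mbaLang] N) : (e (zeroOp M) : Set Ω) = ∅ :=
  congrArg Subtype.val (e.map_fun _ _)

theorem coe_oneOp (e : M ↪[mbaLang] N) : (e (oneOp M) : Set Ω) = Set.univ :=
  congrArg Subtype.val (e.map_fun _ _)

theorem coe_compl (e : M ↪[mbaLang] N) (x : M) :
    (e (symmDiffOp x (oneOp M)) : Set Ω) = (e x : Set Ω)ᶜ := by
  have h : (e (symmDiffOp x (oneOp M)) : Set Ω) = symmDiff (e x : Set Ω) (e (oneOp M)) :=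
    congrArg Subtype.val (e.map_fun _ _)
  rw [h, coe_oneOp]
  exact symmDiff_top _

/-- The atoms of the algebra generated by a finite family are given by terms. -/
theorem exists_coe_eq_pattern {I : Type} (a : I → M) (ε : I → Prop) (s : Finset I) :
    ∃ c : M, ∀ e : M ↪[mbaLang] N, (e c : Set Ω) = {z | ∀ i ∈ s, (z ∈ (e (a i) : Set Ω) ↔ ε i)} := by
  classical
  induction s using Finset.induction_on with
  | empty => exact ⟨oneOp M, fun e => by simp [coe_oneOp]⟩
  | insert i s _ ih =>
    obtain ⟨c, hc⟩ := ih
    by_cases hi : ε i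
    · refine ⟨interOp (a i) c, fun e => ?_⟩
      ext z
      simp [coe_interOp, hc, hi]
    · refine ⟨interOp (symmDiffOp (a i) (oneOp M)) c, fun e => ?_⟩
      ext z
      simp [coe_interOp, hc, coe_compl, hi]

/-- An embedding preserves only the predicates `μ_r`; this determines the measure because every
value occurring in `N` is a rational named by one of them. -/
theorem volume_real_apply_eq (hN : ∀ a ∈ N, ∃ r : Set.Icc (0 : ℚ) 1,
    (volume : Measure Ω).real a = ((r : ℚ) : ℝ)) (e f : M ↪[mbaLang] N) (x : M) :
    (volume : Measure Ω).real (e x) = (volume : Measure Ω).real (f x) := by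
  obtain ⟨r, hr⟩ := hN _ (e x).2
  have h1 := e.map_rel (show mbaLang.Relations 1 from MBARel.measure r) ![x]
  have h2 := f.map_rel (show mbaLang.Relations 1 from MBARel.measure r) ![x]
  rw [hr]
  exact (h2.2 (h1.1 hr)).symm

end Operations

variable {G : Type} [Group G] [TopologicalSpace G] [IsTopologicalGroup G] [CompactSpace G]
  [TotallyDisconnectedSpace G]

/-- There are countably many levels, and each has only finitely many unions of cells. -/
theorem countable_rectAlg [Countable (OpenNormalSubgroup G)] : Countable (rectAlg G) := by
  have h : ∀ a : rectAlg G, ∃ (c : OpenNormalSubgroup G × {m : ℕ // NeZero m}),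
      haveI := c.2.2
      IsLevel c.1 c.2.1 (a : Set (G × UnitIco)) := fun a => by
    obtain ⟨U, m, hm, h⟩ := exists_isLevel a.2
    exact ⟨(U, ⟨m, hm⟩), h⟩
  have hcov : (Set.univ : Set (rectAlg G)) ⊆ ⋃ c : OpenNormalSubgroup G × {m : ℕ // NeZero m},
      {a | haveI := c.2.2; IsLevel c.1 c.2.1 (a : Set (G × UnitIco))} := fun a _ =>
    Set.mem_iUnion.2 (h a)
  refine Set.countable_univ_iff.1 ((Set.countable_iUnion fun c => ?_).mono hcov)
  have := c.2.2
  refine Set.Countable.mono (s₂ := Set.range fun S : {S : Set ((G ⧸ c.1.toSubgroup) × Fin c.2.1) //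
    cellMap c.1 c.2.1 ⁻¹' S ∈ rectAlg G} => (⟨_, S.2⟩ : rectAlg G)) ?_ (Set.countable_range _)
  intro a ha
  obtain ⟨S, hS⟩ := IsLevel.exists_eq ha
  exact ⟨⟨S, hS ▸ a.2⟩, Subtype.ext hS.symm⟩

variable [MeasureSpace G] [BorelSpace G] [IsProbabilityMeasure (volume : Measure G)]
  [(volume : Measure G).IsMulLeftInvariant]

theorem exists_volume_real_eq {a : Set (G × UnitIco)} (ha : a ∈ rectAlg G) :
    ∃ r : Set.Icc (0 : ℚ) 1, (volume : Measure (G × UnitIco)).real a = ((r : ℚ) : ℝ) := by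
  obtain ⟨U, m, _, h⟩ := exists_isLevel ha
  obtain ⟨S, rfl⟩ := h.exists_eq
  have h1 := volume_real_preimage_cellMap U m S
  have h2 : (volume : Measure (G × UnitIco)).real (cellMap U m ⁻¹' S) =
      ((Nat.card S / (Nat.card (G ⧸ U.toSubgroup) * m) : ℚ) : ℝ) := by
    rw [h1]; push_cast; rfl
  refine ⟨⟨_, by positivity, ?_⟩, h2⟩
  have h3 : (volume : Measure (G × UnitIco)).real (cellMap U m ⁻¹' S) ≤ 1 := measureReal_le_one
  rw [h2] at h3
  exact_mod_cast h3

theorem volume_real_pos {a : Set (G × UnitIco)} (ha : a ∈ rectAlg G) (hne : a.Nonempty) :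
    0 < (volume : Measure (G × UnitIco)).real a := by
  obtain ⟨U, m, _, h⟩ := exists_isLevel ha
  obtain ⟨S, rfl⟩ := h.exists_eq
  rw [volume_real_preimage_cellMap]
  obtain ⟨z, hz⟩ := hne
  have : Nonempty S := ⟨⟨_, hz⟩⟩
  have h1 : 0 < Nat.card S := Nat.card_pos
  have h2 : 0 < Nat.card (G ⧸ U.toSubgroup) := Nat.card_pos
  have h3 := NeZero.pos m
  positivity

/-- Isomorphisms between finitely generated subalgebras extend. -/
theorem exists_aut_apply_eq {M : Type} [mbaLang.Structure M] (e f : M ↪[mbaLang] rectAlg G)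
    {I : Type} [Finite I] (a : I → M) :
    ∃ h : rectAlg G ≃[mbaLang] rectAlg G, ∀ i, h (e (a i)) = f (a i) := by
  have := Fintype.ofFinite I
  have key : ∀ (ε : I → Prop) (e : M ↪[mbaLang] rectAlg G),
      (fun (z : G × UnitIco) (i : I) => z ∈ (e (a i) : Set (G × UnitIco))) ⁻¹' {ε} =
        {z | ∀ i ∈ Finset.univ, (z ∈ (e (a i) : Set (G × UnitIco)) ↔ ε i)} := fun ε e => by
    ext z
    simp [funext_iff]
  -- The maps record which generators contain a point. Each fibre is the image of one element `c`
  -- under `e`, respectively `f`, so the two distributions agree.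
  obtain ⟨h, hh⟩ := exists_aut_of_distribution_eq
    (φ := fun (z : G × UnitIco) (i : I) => z ∈ (e (a i) : Set (G × UnitIco)))
    (φ' := fun (z : G × UnitIco) (i : I) => z ∈ (f (a i) : Set (G × UnitIco)))
    (fun ε => by
      obtain ⟨c, hc⟩ := exists_coe_eq_pattern (N := rectAlg G) a ε Finset.univ
      rw [key, ← hc]; exact (e c).2)
    (fun ε => by
      obtain ⟨c, hc⟩ := exists_coe_eq_pattern (N := rectAlg G) a ε Finset.univ
      rw [key, ← hc]; exact (f c).2)
    (fun ε => by
      obtain ⟨c, hc⟩ := exists_coe_eq_pattern (N := rectAlg G) a ε Finset.univ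
      rw [key, key, ← hc, ← hc]
      exact volume_real_apply_eq (fun a ha => exists_volume_real_eq ha) e f c)
  exact ⟨h, fun i => Subtype.ext (hh (e (a i)) {ε | ε i} rfl)⟩

theorem isUltrahomogeneous_rectAlg : IsUltrahomogeneous mbaLang (rectAlg G) := by
  intro S hS f
  obtain ⟨T, hT, hcl⟩ := Structure.fg_iff.1 ((Substructure.fg_iff_structure_fg S).1 hS)
  have : Finite T := hT
  obtain ⟨h, hh⟩ := exists_aut_apply_eq S.subtype f (fun i : T => i.1)
  refine ⟨h, Embedding.toHom_injective (Hom.eq_of_eqOn_dense hcl fun x hx => ?_)⟩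
  exact (hh ⟨x, hx⟩).symm

/-- The Boolean operations do not leave the level shared by the generators, so the image is a
subalgebra of a finite algebra of unions of cells. -/
theorem mem_mbaQ_of_embedding (S : CategoryTheory.Bundled.{0} mbaLang.Structure)
    (hS : Structure.FG mbaLang S) (e : S ↪[mbaLang] rectAlg G) : S ∈ mbaQ := by
  obtain ⟨T, hT, hcl⟩ := Structure.fg_iff.1 hS
  obtain ⟨U, m, _, hL⟩ := exists_isLevel_of_finite (hT.image fun x => (e x : Set (G × UnitIco)))
    (by rintro _ ⟨x, -, rfl⟩; exact (e x).2)
  have hlev : ∀ x : S, IsLevel U m (e x : Set (G × UnitIco)) := by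
    intro x
    have hx : x ∈ Substructure.closure mbaLang T := hcl ▸ Substructure.mem_top x
    refine Substructure.closure_induction hx (fun x hx => hL _ ⟨x, hx, rfl⟩) ?_
    intro n F x hx z z' hzz'
    have hF := congrArg Subtype.val (e.map_fun F x)
    change z ∈ (e (funMap F x)).1 ↔ z' ∈ (e (funMap F x)).1
    rw [hF]
    cases F with
    | zero => exact Iff.rfl
    | one => exact Iff.rfl
    | inter => exact and_congr (hx 0 z z' hzz') (hx 1 z z' hzz')
    | union => exact or_congr (hx 0 z z' hzz') (hx 1 z z' hzz')
    | symmDiff =>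
      exact or_congr (and_congr (hx 0 z z' hzz') (not_congr (hx 1 z z' hzz')))
        (and_congr (hx 1 z z' hzz') (not_congr (hx 0 z z' hzz')))
  let B : BooleanSubalgebra (Set (G × UnitIco)) :=
    { carrier := Set.range fun x => (e x : Set (G × UnitIco))
      supClosed' := by
        rintro _ ⟨x, rfl⟩ _ ⟨y, rfl⟩
        exact ⟨unionOp x y, coe_unionOp e x y⟩
      infClosed' := by
        rintro _ ⟨x, rfl⟩ _ ⟨y, rfl⟩
        exact ⟨interOp x y, coe_interOp e x y⟩
      compl_mem' := by
        rintro _ ⟨x, rfl⟩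
        exact ⟨_, coe_compl e x⟩
      bot_mem' := ⟨_, coe_zeroOp e⟩ }
  have hB : ∀ b : B, ∃ x, (e x : Set (G × UnitIco)) = b := fun b => b.2
  have hfin : Finite B := by
    refine Finite.of_injective (fun b : B => cellMap U m '' (b : Set (G × UnitIco))) ?_
    intro b b' hbb'
    apply Subtype.ext
    have key : ∀ b : B, (b : Set (G × UnitIco)) = cellMap U m ⁻¹' (cellMap U m '' b) := by
      intro b
      obtain ⟨x, hx⟩ := hB b
      refine Set.Subset.antisymm (Set.subset_preimage_image _ _) ?_
      rintro z ⟨z', hz', hzz'⟩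
      rw [← hx] at hz' ⊢
      exact (hlev x _ _ hzz').1 hz'
    rw [key b, key b']
    exact congrArg _ hbb'
  let e₀ : S → B := fun x => ⟨e x, x, rfl⟩
  have he₀ : Function.Bijective e₀ := by
    constructor
    · intro x y hxy
      exact e.injective (Subtype.ext (congrArg (fun b : B => (b : Set (G × UnitIco))) hxy))
    · intro b
      obtain ⟨x, hx⟩ := hB b
      exact ⟨x, Subtype.ext hx⟩
  refine ⟨B, inferInstance, fun b => (volume : Measure (G × UnitIco)).real b, hfin,
    ⟨?_, ?_, ?_, ?_⟩, ⟨⟨Equiv.ofBijective e₀ he₀, ?_, ?_⟩⟩⟩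
  · exact probReal_univ
  · intro a b hab
    obtain ⟨y, hy⟩ := hB b
    refine measureReal_union ?_ (hy ▸ (hlev y).measurableSet)
    rw [Set.disjoint_iff_inter_eq_empty]
    exact congrArg Subtype.val (disjoint_iff.1 hab)
  · intro a ha
    obtain ⟨x, hx⟩ := hB a
    refine volume_real_pos (hx ▸ (e x).2) (Set.nonempty_iff_ne_empty.2 fun h => ha ?_)
    exact Subtype.ext h
  · intro a
    obtain ⟨x, hx⟩ := hB a
    obtain ⟨r, hr⟩ := exists_volume_real_eq (hx ▸ (e x).2 : (a : Set (G × UnitIco)) ∈ rectAlg G)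
    exact ⟨r, hr⟩
  · intro n F x
    apply Subtype.ext
    refine (congrArg Subtype.val (e.map_fun F x)).trans ?_
    cases F <;> rfl
  · intro n R x
    refine Iff.trans ?_ (e.map_rel R x)
    cases R
    exact Iff.rfl

/-! ### Realizing finite rational measured algebras -/

section FiniteAlgebra

variable {B : Type} [BooleanAlgebra B] [Finite B] {m : B → ℝ}

theorem IsRationalMeasure.bot (hm : IsRationalMeasure m) : m ⊥ = 0 := by
  have := hm.add ⊥ ⊥ disjoint_bot_left
  rw [sup_idem] at this
  linarith

theorem IsRationalMeasure.finset_sup (hm : IsRationalMeasure m) (s : Finset {a : B // IsAtom a}) :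
    m (s.sup fun a => a.1) = ∑ a ∈ s, m a.1 := by
  classical
  induction s using Finset.induction_on with
  | empty => simp [hm.bot]
  | insert a s ha ih =>
    rw [Finset.sup_insert, Finset.sum_insert ha, hm.add, ih]
    rw [Finset.disjoint_sup_right]
    intro b hb
    exact a.2.disjoint_of_ne b.2 fun h => ha (Subtype.ext h ▸ hb)

theorem sup_atoms_le [Fintype {a : B // IsAtom a}] (b : B)
    [DecidablePred fun a : {a : B // IsAtom a} => a.1 ≤ b] :
    (Finset.univ.filter fun a : {a : B // IsAtom a} => a.1 ≤ b).sup (fun a => a.1) = b := by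
  refine le_antisymm (Finset.sup_le fun a ha => (Finset.mem_filter.1 ha).2) ?_
  refine BooleanAlgebra.le_iff_atom_le_imp.2 fun a ha hab => ?_
  exact Finset.le_sup (f := fun a : {a : B // IsAtom a} => a.1) (b := ⟨a, ha⟩)
    (Finset.mem_filter.2 ⟨Finset.mem_univ _, hab⟩)

theorem isAtom_le_sup_iff {a b c : B} (ha : IsAtom a) : a ≤ b ⊔ c ↔ a ≤ b ∨ a ≤ c := by
  refine ⟨fun h => ?_, fun h => h.elim le_sup_of_le_left le_sup_of_le_right⟩
  by_contra! hbc
  have h1 := ha.not_le_iff_disjoint.1 hbc.1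
  have h2 := ha.not_le_iff_disjoint.1 hbc.2
  exact ha.1 ((h1.sup_right h2).eq_bot_of_le h)

theorem isAtom_le_sdiff_iff {a b c : B} (ha : IsAtom a) : a ≤ b \ c ↔ a ≤ b ∧ ¬ a ≤ c := by
  rw [ha.not_le_iff_disjoint, le_sdiff]

/-- Rational weights have a common denominator. -/
theorem exists_common_denominator {X : Type} [Finite X] (w : X → ℝ) (hw : ∀ x, 0 ≤ w x)
    (hq : ∀ x, ∃ q : ℚ, w x = q) :
    ∃ (n : ℕ) (_ : NeZero n) (c : X → ℕ), ∀ x, (c x : ℝ) = n * w x := by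
  have := Fintype.ofFinite X
  choose q hq using hq
  refine ⟨∏ x, (q x).den, ⟨Finset.prod_ne_zero_iff.2 fun x _ => (q x).den_nz⟩, ?_⟩
  have h : ∀ x, ∃ c : ℕ, (c : ℝ) = (∏ x, (q x).den : ℕ) * w x := by
    intro x
    obtain ⟨d, hd⟩ := Finset.dvd_prod_of_mem (fun x => (q x).den) (Finset.mem_univ x)
    have hnum : 0 ≤ (q x).num := by
      have := hw x
      rw [hq x] at this
      exact Rat.num_nonneg.2 (by exact_mod_cast this)
    refine ⟨(q x).num.toNat * d, ?_⟩
    have h1 : (((q x).num.toNat : ℕ) : ℝ) = ((q x).num : ℝ) := by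
      exact_mod_cast Int.toNat_of_nonneg hnum
    have h2 : ((q x).den : ℝ) * (q x : ℝ) = (q x).num := by
      exact_mod_cast Rat.den_mul_eq_num (q x)
    rw [hd, hq x]
    push_cast
    rw [h1, ← h2]
    ring
  choose c hc using h
  exact ⟨c, hc⟩

/-- Every finite rational probability distribution is the distribution of a map with fibres in the
algebra. -/
theorem exists_map_of_distribution (G : Type) [Group G] [TopologicalSpace G] [IsTopologicalGroup G]
    [CompactSpace G] [TotallyDisconnectedSpace G] [MeasureSpace G] [BorelSpace G]
    [IsProbabilityMeasure (volume : Measure G)] [(volume : Measure G).IsMulLeftInvariant]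
    {X : Type} [Fintype X] (w : X → ℝ) (hw : ∀ x, 0 ≤ w x) (hq : ∀ x, ∃ q : ℚ, w x = q)
    (hsum : ∑ x, w x = 1) : ∃ φ : G × UnitIco → X, (∀ S, φ ⁻¹' S ∈ rectAlg G) ∧
      (∀ S, MeasurableSet (φ ⁻¹' S)) ∧
      ∀ x, (volume : Measure (G × UnitIco)).real (φ ⁻¹' {x}) = w x := by
  obtain ⟨n, _, c, hc⟩ := exists_common_denominator w hw hq
  obtain ⟨U, -⟩ := exists_openNormalSubgroup_of_isClopen (G := G) isClopen_univ
  have hcard : Nat.card (Σ x, Fin (c x)) = n := by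
    rw [Nat.card_sigma]
    have : ((∑ x, Nat.card (Fin (c x)) : ℕ) : ℝ) = n := by
      simp only [Nat.card_fin]
      push_cast
      rw [Finset.sum_congr rfl fun x _ => hc x, ← Finset.mul_sum, hsum, mul_one]
    exact_mod_cast this
  -- Of the `n` equal intervals, `c x = n * w x` are assigned to `x`. The group coordinate plays no
  -- role, so `U` is arbitrary.
  let e : (Σ x, Fin (c x)) ≃ Fin n := (Finite.equivFin _).trans (finCongr hcard)
  have hpre : ∀ S, (fun z : G × UnitIco => (e.symm (ivl n z.2)).1) ⁻¹' S =
      cellMap U n ⁻¹' (Set.univ ×ˢ {j | (e.symm j).1 ∈ S}) := by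
    intro S
    ext z
    simp [cellMap]
  refine ⟨fun z => (e.symm (ivl n z.2)).1, fun S => ?_, fun S => ?_, fun x => ?_⟩
  · rw [hpre]
    exact (isLevel_preimage U n _).mem_tensor
  · rw [hpre]
    exact measurableSet_preimage_cellMap U n _
  · rw [hpre, volume_real_preimage_cellMap]
    have h1 : Nat.card {j | (e.symm j).1 ∈ ({x} : Set X)} = c x := by
      have : {j // (e.symm j).1 = x} ≃ {s : Σ x, Fin (c x) // s.1 = x} :=
        e.symm.subtypeEquiv fun _ => Iff.rfl
      have h2 := Nat.card_congr (this.trans (Equiv.sigmaSubtype x))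
      rw [Nat.card_fin] at h2
      exact h2
    have h3 : Nat.card ((Set.univ : Set (G ⧸ U.toSubgroup)) ×ˢ {j | (e.symm j).1 ∈ ({x} : Set X)} :
        Set _) = Nat.card (G ⧸ U.toSubgroup) * c x := by
      rw [← h1, Nat.card_congr (Equiv.Set.prod _ _), Nat.card_prod, Nat.card_univ]
    rw [h3]
    have hG : (0 : ℝ) < Nat.card (G ⧸ U.toSubgroup) := Nat.cast_pos.2 Nat.card_pos
    have hn : (0 : ℝ) < n := Nat.cast_pos.2 (NeZero.pos n)
    push_cast
    rw [hc]
    field_simp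

/-- A map `φ` to the atoms with distribution `m` gives the embedding `b ↦ φ ⁻¹' {a | a ≤ b}`. Strict
positivity makes `φ` surjective, hence the embedding injective. -/
theorem nonempty_embedding_rectAlg (hm : IsRationalMeasure m) :
    letI : mbaLang.Structure B := mbaStructure B m
    Nonempty (B ↪[mbaLang] rectAlg G) := by
  classical
  have := Fintype.ofFinite {a : B // IsAtom a}
  have hsum : ∀ b : B, ∑ a : {a : B // IsAtom a} with a.1 ≤ b, m a.1 = m b := fun b => by
    rw [← hm.finset_sup, sup_atoms_le]
  obtain ⟨φ, hφ, hφm, hφw⟩ := exists_map_of_distribution G (fun a : {a : B // IsAtom a} => m a.1)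
    (fun a => (hm.pos _ a.2.1).le) (fun a => hm.rational _) (by
      have := hsum ⊤
      simpa only [le_top, Finset.filter_true, hm.top] using this)
  let ι : B → rectAlg G := fun b => ⟨φ ⁻¹' {a | a.1 ≤ b}, hφ _⟩
  have hι : ∀ b, (ι b : Set (G × UnitIco)) = φ ⁻¹' {a | a.1 ≤ b} := fun b => rfl
  have hvol : ∀ b, (volume : Measure (G × UnitIco)).real (ι b) = m b := by
    intro b
    have h2 := sum_measureReal_preimage_singleton (μ := (volume : Measure (G × UnitIco)))
      (f := φ) (Finset.univ.filter fun a : {a : B // IsAtom a} => a.1 ≤ b) (fun x _ => hφm {x})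
    rw [Finset.sum_congr rfl fun x _ => hφw x, hsum] at h2
    rw [h2, hι]
    congr 2
    ext a
    simp
  have hne : ∀ a, ∃ z, φ z = a := fun a => by
    by_contra! h
    have h1 : φ ⁻¹' {a} = ∅ := Set.eq_empty_iff_forall_notMem.2 h
    have h2 := hφw a
    rw [h1, measureReal_empty] at h2
    exact (hm.pos _ a.2.1).ne h2
  have hinj : Function.Injective ι := by
    intro b c hbc
    refine BooleanAlgebra.eq_iff_atom_le_iff.2 fun a ha => ?_
    obtain ⟨z, hz⟩ := hne ⟨a, ha⟩
    have h1 : z ∈ (ι b : Set (G × UnitIco)) ↔ z ∈ (ι c : Set (G × UnitIco)) := by rw [hbc]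
    rw [hι, hι, Set.mem_preimage, Set.mem_preimage, hz] at h1
    exact h1
  let _ : mbaLang.Structure B := mbaStructure B m
  refine ⟨⟨⟨ι, hinj⟩, ?_, ?_⟩⟩
  · intro n F x
    apply Subtype.ext
    ext z
    cases F with
    | zero => exact ⟨fun h => (φ z).2.1 (le_bot_iff.1 h), fun h => h.elim⟩
    | one => exact ⟨fun _ => Set.mem_univ _, fun _ => le_top⟩
    | inter => exact le_inf_iff
    | union => exact isAtom_le_sup_iff (φ z).2
    | symmDiff =>
      refine (isAtom_le_sup_iff (φ z).2).trans ?_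
      exact or_congr (isAtom_le_sdiff_iff (φ z).2) (isAtom_le_sdiff_iff (φ z).2)
  · intro n R x
    cases R with
    | measure r =>
      change (volume : Measure (G × UnitIco)).real (ι (x 0)) = _ ↔ m (x 0) = _
      rw [hvol]

end FiniteAlgebra

theorem age_rectAlg : mbaLang.age (rectAlg G) = mbaQ := by
  ext S
  constructor
  · rintro ⟨hFG, ⟨e⟩⟩
    exact mem_mbaQ_of_embedding S hFG e
  · rintro ⟨B, _, m, _, hm, ⟨f⟩⟩
    let _ : mbaLang.Structure B := mbaStructure B m
    have : Finite S := Finite.of_equiv B f.symm.toEquiv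
    obtain ⟨e⟩ := nonempty_embedding_rectAlg (G := G) hm
    exact ⟨Structure.FG.of_finite, ⟨e.comp f.toEmbedding⟩⟩

theorem isFraisseLimit_rectAlg [Countable (rectAlg G)] : IsFraisseLimit mbaQ (rectAlg G) :=
  ⟨isUltrahomogeneous_rectAlg, age_rectAlg⟩

end FraisseLimit

/-! ### The profinite completion -/

section Completion

variable {k : ℕ}

instance fHat_isMulLeftInvariant (k : ℕ) : (volume : Measure (FHat k)).IsMulLeftInvariant :=
  inferInstanceAs ((Measure.haarMeasure ⊤ : Measure (FHat k)).IsMulLeftInvariant)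

instance fHat_isProbabilityMeasure (k : ℕ) : IsProbabilityMeasure (volume : Measure (FHat k)) := by
  constructor
  have := Measure.haarMeasure_self (G := FHat k) (K₀ := ⊤)
  rwa [TopologicalSpace.PositiveCompacts.coe_top] at this

theorem denseRange_toFHat (k : ℕ) : DenseRange (toFHat k) :=
  ProfiniteGrp.ProfiniteCompletion.denseRange _

/-- Permutations of a finite set define an action of the profinite completion. -/
theorem exists_extension_toFHat {X : Type} [Finite X] (σ : Fin k → Equiv.Perm X) :
    ∃ ρ : FHat k →* Equiv.Perm X, (∀ s, IsOpen (ρ ⁻¹' s)) ∧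
      ∀ w, ρ (toFHat k w) = FreeGroup.lift σ w := by
  have : Finite (Equiv.Perm X) := inferInstance
  let P : ProfiniteGrp.{0} := ProfiniteGrp.ofFiniteGrp (FiniteGrp.of (Equiv.Perm X))
  let f : GrpCat.of (FreeGroup (Fin k)) ⟶ GrpCat.of P := GrpCat.ofHom (FreeGroup.lift σ)
  let ρ := (ProfiniteGrp.ProfiniteCompletion.lift f).hom
  refine ⟨ρ.toMonoidHom, fun s => ?_, fun w => ?_⟩
  · let _ : TopologicalSpace (Equiv.Perm X) := ⊥
    have : DiscreteTopology (Equiv.Perm X) := ⟨rfl⟩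
    exact (isOpen_discrete s).preimage ρ.continuous_toFun
  · have h := ProfiniteGrp.ProfiniteCompletion.lift_eta f
    exact CategoryTheory.ConcreteCategory.congr_hom h w

/-- Every coset of an open normal subgroup meets the free group. -/
theorem exists_mk_toFHat_eq (U : OpenNormalSubgroup (FHat k)) (z : FHat k) :
    ∃ w, (QuotientGroup.mk (toFHat k w) : FHat k ⧸ U.toSubgroup) = QuotientGroup.mk z := by
  obtain ⟨w, hw⟩ := (denseRange_toFHat k).exists_mem_open
    (isClopen_setOf_mk_eq U (QuotientGroup.mk z)).isOpen ⟨z, rfl⟩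
  exact ⟨w, hw⟩

/-- By density an open normal subgroup is determined by its trace on the free group. The trace is
the kernel of the action on the finite quotient, which is encoded by `k` permutations of some `Fin
n`. -/
theorem countable_openNormalSubgroup_fHat (k : ℕ) : Countable (OpenNormalSubgroup (FHat k)) := by
  have h : ∀ U : OpenNormalSubgroup (FHat k), ∃ c : Σ n, (Fin k → Equiv.Perm (Fin n)),
      ∀ w, toFHat k w ∈ U ↔ FreeGroup.lift c.2 w = 1 := by
    intro U
    let e := Finite.equivFin (FHat k ⧸ U.toSubgroup)
    let θ : FreeGroup (Fin k) →* Equiv.Perm (Fin (Nat.card (FHat k ⧸ U.toSubgroup))) :=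
      e.permCongrHom.toMonoidHom.comp ((MulAction.toPermHom (FHat k ⧸ U.toSubgroup)
        (FHat k ⧸ U.toSubgroup)).comp ((QuotientGroup.mk' U.toSubgroup).comp (toFHat k)))
    refine ⟨⟨_, fun i => θ (FreeGroup.of i)⟩, fun w => ?_⟩
    have hθ : FreeGroup.lift (fun i => θ (FreeGroup.of i)) = θ := by
      ext i; simp
    rw [hθ]
    change _ ↔ e.permCongrHom (MulAction.toPermHom (FHat k ⧸ U.toSubgroup)
        (FHat k ⧸ U.toSubgroup) (QuotientGroup.mk (toFHat k w))) = 1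
    rw [map_eq_one_iff _ e.permCongrHom.injective,
      map_eq_one_iff _ MulAction.toPerm_injective, QuotientGroup.eq_one_iff]
    rfl
  choose c hc using h
  refine Function.Injective.countable (f := c) fun U V hUV => ?_
  have key : ∀ U V : OpenNormalSubgroup (FHat k), c U = c V → U ≤ V := by
    intro U V hUV z hz
    obtain ⟨w, hw⟩ := exists_mk_toFHat_eq (U ⊓ V) z
    have h1 := QuotientGroup.eq.1 hw
    have h2 : (toFHat k w)⁻¹ * z ∈ U := h1.1
    have h3 : (toFHat k w)⁻¹ * z ∈ V := h1.2
    have h4 : toFHat k w ∈ U := by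
      have := mul_mem hz (inv_mem h2)
      simpa using this
    have h5 : toFHat k w ∈ V := by
      rw [hc, ← hUV, ← hc]; exact h4
    have := mul_mem h5 h3
    simpa using this
  exact le_antisymm (key U V hUV) (key V U hUV.symm)

end Completion

/-! ### Equidistributed lifts -/

section Lifts

/-- A map `base : Fin m → X` can be randomized along the fibres of `pr`. -/
theorem exists_equidistributed_lift {X Y : Type} [Finite X] (pr : X → Y) {m : ℕ} [NeZero m]
    (base : Fin m → X) : ∃ (l : ℕ) (_ : NeZero l) (F : Fin (m * l) → X),
      (∀ j i, pr (F (finProdFinEquiv (j, i))) = pr (base j)) ∧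
      ∀ x x', pr x = pr x' → Nat.card {j // F j = x} = Nat.card {j // F j = x'} := by
  classical
  -- Each interval is cut into one piece for every permutation preserving the fibres of `pr`, and on
  -- that piece `base` is moved by this permutation.
  let H : Type := {τ : Equiv.Perm X // ∀ x, pr (τ x) = pr x}
  have : Nonempty H := ⟨⟨1, fun _ => rfl⟩⟩
  have hfin : Finite H := inferInstance
  let e := Finite.equivFin H
  refine ⟨Nat.card H, ⟨Nat.card_pos.ne'⟩, fun n =>
    (e.symm (finProdFinEquiv.symm n).2).1 (base (finProdFinEquiv.symm n).1), ?_, ?_⟩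
  · intro j i
    beta_reduce
    rw [Equiv.symm_apply_apply]
    exact (e.symm i).2 _
  · intro x x' hx
    -- Left multiplication by the transposition permutes `H` and so exchanges the pieces with value
    -- `x` and those with value `x'`.
    let α : H := ⟨Equiv.swap x x', fun y => by
      by_cases h1 : y = x
      · rw [h1, Equiv.swap_apply_left, hx]
      · by_cases h2 : y = x'
        · rw [h2, Equiv.swap_apply_right, hx]
        · rw [Equiv.swap_apply_of_ne_of_ne h1 h2]⟩
    let β : H ≃ H :=
      { toFun := fun τ => ⟨α.1 * τ.1, fun y => (α.2 _).trans (τ.2 y)⟩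
        invFun := fun τ => ⟨α.1⁻¹ * τ.1, fun y => by
          
          rw [← α.2, Equiv.Perm.mul_apply]
          exact (congrArg pr (α.1.apply_symm_apply _)).trans (τ.2 y)⟩
        left_inv := fun τ => Subtype.ext (inv_mul_cancel_left _ _)
        right_inv := fun τ => Subtype.ext (mul_inv_cancel_left _ _) }
    let γ : Fin (m * Nat.card H) ≃ Fin (m * Nat.card H) :=
      finProdFinEquiv.symm.trans (((Equiv.refl _).prodCongr (e.symm.trans (β.trans e))).trans
        finProdFinEquiv)
    refine Nat.card_congr (γ.subtypeEquiv fun n => ?_)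
    have h1 : (finProdFinEquiv.symm (γ n)).1 = (finProdFinEquiv.symm n).1 := by
      simp only [γ, Equiv.trans_apply, Equiv.symm_apply_apply]; rfl
    have h2 : e.symm (finProdFinEquiv.symm (γ n)).2 = β (e.symm (finProdFinEquiv.symm n).2) := by
      simp only [γ, Equiv.trans_apply, Equiv.symm_apply_apply]
      exact e.symm_apply_apply _
    beta_reduce
    rw [h1, h2]
    change _ ↔ Equiv.swap x x' _ = x'
    rw [Equiv.swap_apply_eq_iff, Equiv.swap_apply_right]

/-- Two maps with the same composition with `pr`, whose distributions are constant along the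
fibres of `pr`, have the same distribution. -/
theorem distribution_eq_of_comp_eq {Ω X Y : Type} [MeasurableSpace Ω] (μ : Measure Ω)
    [IsProbabilityMeasure μ] [Finite X] {φ φ' : Ω → X} {pr : X → Y}
    (hφ : ∀ x, MeasurableSet (φ ⁻¹' {x})) (hφ' : ∀ x, MeasurableSet (φ' ⁻¹' {x}))
    (h : ∀ z, pr (φ z) = pr (φ' z))
    (hc : ∀ x x', pr x = pr x' → μ.real (φ ⁻¹' {x}) = μ.real (φ ⁻¹' {x'}))
    (hc' : ∀ x x', pr x = pr x' → μ.real (φ' ⁻¹' {x}) = μ.real (φ' ⁻¹' {x'})) (x : X) :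
    μ.real (φ ⁻¹' {x}) = μ.real (φ' ⁻¹' {x}) := by
  classical
  have := Fintype.ofFinite X
  let s := Finset.univ.filter fun x' => pr x' = pr x
  have h1 := sum_measureReal_preimage_singleton (μ := μ) (f := φ) s fun x _ => hφ x
  have h2 := sum_measureReal_preimage_singleton (μ := μ) (f := φ') s fun x _ => hφ' x
  have h3 : φ ⁻¹' s = φ' ⁻¹' s := by
    ext z
    simp [s, h]
  rw [h3, ← h2, Finset.sum_congr rfl fun x' hx' => hc x' x (Finset.mem_filter.1 hx').2,
    Finset.sum_congr rfl fun x' hx' => hc' x' x (Finset.mem_filter.1 hx').2, Finset.sum_const,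
    Finset.sum_const] at h1
  have h4 : s.card ≠ 0 := Finset.card_ne_zero.2 ⟨x, Finset.mem_filter.2 ⟨Finset.mem_univ _, rfl⟩⟩
  exact smul_right_injective ℝ h4 h1

end Lifts

/-! ### Genericity -/

section Generic

variable {k : ℕ}

theorem IsLevel.mem_image_iff {G : Type} [Group G] [TopologicalSpace G] {U : OpenNormalSubgroup G}
    {m : ℕ} [NeZero m] {a : Set (G × UnitIco)} (h : IsLevel U m a) (z : G × UnitIco) :
    cellMap U m z ∈ cellMap U m '' a ↔ z ∈ a := by
  refine ⟨?_, fun hz => ⟨z, hz, rfl⟩⟩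
  rintro ⟨z', hz', hzz'⟩
  exact (h _ _ hzz').1 hz'

theorem IsLevel.preimage_image {G : Type} [Group G] [TopologicalSpace G] {U : OpenNormalSubgroup G}
    {m : ℕ} [NeZero m] {a : Set (G × UnitIco)} (h : IsLevel U m a) :
    cellMap U m ⁻¹' (cellMap U m '' a) = a :=
  Set.ext h.mem_image_iff

/-- An isomorphism between finitely generated subalgebras is induced by a permutation of cells. -/
theorem exists_perm_cells {G : Type} [Group G] [TopologicalSpace G] [IsTopologicalGroup G]
    [CompactSpace G] [TotallyDisconnectedSpace G] [MeasureSpace G] [BorelSpace G]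
    [IsProbabilityMeasure (volume : Measure G)] [(volume : Measure G).IsMulLeftInvariant]
    {M : Type} [mbaLang.Structure M] (e f : M ↪[mbaLang] rectAlg G) {I : Type} [Finite I]
    (a : I → M) {U : OpenNormalSubgroup G} {m : ℕ} [NeZero m]
    (he : ∀ i, IsLevel U m (e (a i) : Set (G × UnitIco)))
    (hf : ∀ i, IsLevel U m (f (a i) : Set (G × UnitIco))) :
    ∃ σ : Equiv.Perm ((G ⧸ U.toSubgroup) × Fin m), ∀ i x,
      (σ x ∈ cellMap U m '' (f (a i) : Set (G × UnitIco)) ↔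
        x ∈ cellMap U m '' (e (a i) : Set (G × UnitIco))) := by
  have := Fintype.ofFinite I
  obtain ⟨σ, hσ⟩ := exists_perm_of_card_fiber_eq
    (fun x (i : I) => x ∈ cellMap U m '' (e (a i) : Set (G × UnitIco)))
    (fun x (i : I) => x ∈ cellMap U m '' (f (a i) : Set (G × UnitIco))) fun ε => by
      obtain ⟨c, hc⟩ := exists_coe_eq_pattern (N := rectAlg G) a ε Finset.univ
      have h1 := volume_real_apply_eq (fun a ha => exists_volume_real_eq ha) e f c
      have key : ∀ e : M ↪[mbaLang] rectAlg G,
          (∀ i, IsLevel U m (e (a i) : Set (G × UnitIco))) → (e c : Set (G × UnitIco)) =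
          cellMap U m ⁻¹' {x | (fun i => x ∈ cellMap U m '' (e (a i) : Set (G × UnitIco))) = ε} := by
        intro e he
        rw [hc]
        ext z
        simp only [Set.mem_preimage, Set.mem_ofPred_eq, funext_iff, Finset.mem_univ, true_imp_iff,
          (he _).mem_image_iff, eq_iff_iff]
      rw [key e he, key f hf, volume_real_preimage_cellMap, volume_real_preimage_cellMap] at h1
      have hpos : (0 : ℝ) < Nat.card (G ⧸ U.toSubgroup) * m :=
        mul_pos (Nat.cast_pos.2 Nat.card_pos) (Nat.cast_pos.2 (NeZero.pos m))
      exact_mod_cast (div_left_inj' hpos.ne').1 h1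
  exact ⟨σ, fun i x => iff_of_eq (congrFun (hσ x) i)⟩

theorem coe_profiniteTimesTrivial (w : FreeGroup (Fin k)) (a : algN k) :
    (profiniteTimesTrivial k w a : Set (FHat k × UnitIco)) = translate k w '' a := rfl

theorem mem_profiniteTimesTrivial_iff (w : FreeGroup (Fin k)) (a : algN k)
    (z : FHat k × UnitIco) : z ∈ (profiniteTimesTrivial k w a : Set (FHat k × UnitIco)) ↔
      translate k w⁻¹ z ∈ (a : Set (FHat k × UnitIco)) := by
  rw [coe_profiniteTimesTrivial, MeasurableEquiv.image_eq_preimage_symm, translate_symm]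
  rfl

theorem IsLevel.translate {U : OpenNormalSubgroup (FHat k)} {m : ℕ} [NeZero m] {a : algN k}
    (h : IsLevel U m (a : Set (FHat k × UnitIco))) (w : FreeGroup (Fin k)) :
    IsLevel U m (profiniteTimesTrivial k w a : Set (FHat k × UnitIco)) := by
  intro z z' hz
  rw [mem_profiniteTimesTrivial_iff, mem_profiniteTimesTrivial_iff]
  refine h _ _ (Prod.ext ?_ (show ivl m z.2 = ivl m z'.2 from congrArg Prod.snd hz))
  have h1 := congrArg Prod.fst hz
  rw [translate_apply, translate_apply]
  change (QuotientGroup.mk (_ * _) : FHat k ⧸ U.toSubgroup) = QuotientGroup.mk (_ * _)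
  rw [QuotientGroup.mk_mul, QuotientGroup.mk_mul]
  exact congrArg _ h1

/-- Left translation permutes the cosets of `U`, so the finitely many unions of cells of a given
level form an invariant set. -/
theorem exists_finite_invariant (a : algN k) : ∃ D : Finset (algN k), a ∈ D ∧
    ∀ i, ∀ b ∈ D, profiniteTimesTrivial k (FreeGroup.of i) b ∈ D := by
  obtain ⟨U, m, _, h⟩ := exists_isLevel a.2
  have hfin : {b : algN k | IsLevel U m (b : Set (FHat k × UnitIco))}.Finite := by
    refine Set.Finite.of_finite_image
      (f := fun b : algN k => cellMap U m '' (b : Set (FHat k × UnitIco))) (Set.toFinite _) ?_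
    intro b hb b' hb' hbb'
    apply Subtype.ext
    rw [← IsLevel.preimage_image hb, ← IsLevel.preimage_image hb']
    exact congrArg _ hbb'
  refine ⟨hfin.toFinset, hfin.mem_toFinset.2 h, fun i b hb => ?_⟩
  rw [Set.Finite.mem_toFinset] at hb ⊢
  exact IsLevel.translate hb _

/-- The action of the free group on a finite invariant set of unions of cells is compatible with
an action on the cells which is compatible with it for the generators. -/
theorem lift_mem_image_cellMap_iff {U : OpenNormalSubgroup (FHat k)} {m : ℕ} [NeZero m]
    {D : Finset (algN k)} (hD : ∀ i, ∀ d ∈ D, profiniteTimesTrivial k (FreeGroup.of i) d ∈ D)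
    {σ : Fin k → Equiv.Perm ((FHat k ⧸ U.toSubgroup) × Fin m)}
    (hσ : ∀ i, ∀ d ∈ D, ∀ x, (σ i x ∈ cellMap U m ''
        (profiniteTimesTrivial k (FreeGroup.of i) d : Set (FHat k × UnitIco)) ↔
      x ∈ cellMap U m '' (d : Set (FHat k × UnitIco)))) (w : FreeGroup (Fin k)) :
    ∀ d ∈ D, profiniteTimesTrivial k w d ∈ D ∧ ∀ x,
      (FreeGroup.lift σ w x ∈ cellMap U m ''
          (profiniteTimesTrivial k w d : Set (FHat k × UnitIco)) ↔
        x ∈ cellMap U m '' (d : Set (FHat k × UnitIco))) := by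
  have hinv : ∀ w : FreeGroup (Fin k), (∀ d ∈ D, profiniteTimesTrivial k w d ∈ D ∧ ∀ x,
      (FreeGroup.lift σ w x ∈ cellMap U m ''
          (profiniteTimesTrivial k w d : Set (FHat k × UnitIco)) ↔
        x ∈ cellMap U m '' (d : Set (FHat k × UnitIco)))) →
      ∀ d ∈ D, profiniteTimesTrivial k w⁻¹ d ∈ D ∧ ∀ x,
      (FreeGroup.lift σ w⁻¹ x ∈ cellMap U m ''
          (profiniteTimesTrivial k w⁻¹ d : Set (FHat k × UnitIco)) ↔
        x ∈ cellMap U m '' (d : Set (FHat k × UnitIco))) := by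
    intro w hw d hd
    -- An injective self-map of the finite set `D` is onto, so `D` is invariant under inverses as
    -- well.
    obtain ⟨d', hd', rfl⟩ := Finset.surj_on_of_inj_on_of_card_le
      (s := D) (t := D) (fun d _ => profiniteTimesTrivial k w d) (fun d hd => (hw d hd).1)
      (fun _ _ _ _ h => (profiniteTimesTrivial k w).injective h) le_rfl d hd
    have h1 : profiniteTimesTrivial k w⁻¹ (profiniteTimesTrivial k w d') = d' := by
      rw [map_inv, aut_inv_apply_self]
    rw [h1]
    refine ⟨hd', fun x => ?_⟩
    rw [← (hw d' hd').2, ← Equiv.Perm.mul_apply, ← map_mul, mul_inv_cancel, map_one,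
      Equiv.Perm.one_apply]
  induction w using FreeGroup.induction_on with
  | C1 =>
    intro d hd
    rw [map_one, map_one]
    exact ⟨hd, fun x => Iff.rfl⟩
  | of i =>
    intro d hd
    refine ⟨hD i d hd, fun x => ?_⟩
    rw [FreeGroup.lift_apply_of]
    exact hσ i d hd x
  | inv_of i h => exact hinv _ h
  | mul v w hv hw =>
    intro d hd
    have h1 := hw d hd
    have h2 := hv _ h1.1
    rw [map_mul, map_mul]
    exact ⟨h2.1, fun x => (h2.2 _).trans (h1.2 x)⟩

/-- An extension of the restriction of the action to a finite invariant set to a finite measured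
algebra with an equidistributed measure is realized in the algebra by an equivariant map, whose
value at a point is the name of an atom. -/
theorem exists_equivariant_map {U : OpenNormalSubgroup (FHat k)} {m : ℕ} [NeZero m]
    {D : Finset (algN k)} (hD : ∀ i, ∀ d ∈ D, profiniteTimesTrivial k (FreeGroup.of i) d ∈ D)
    (hDl : ∀ d ∈ D, IsLevel U m (d : Set (FHat k × UnitIco)))
    {σ : Fin k → Equiv.Perm ((FHat k ⧸ U.toSubgroup) × Fin m)}
    (hσ : ∀ i, ∀ d ∈ D, ∀ x, (σ i x ∈ cellMap U m ''
        (profiniteTimesTrivial k (FreeGroup.of i) d : Set (FHat k × UnitIco)) ↔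
      x ∈ cellMap U m '' (d : Set (FHat k × UnitIco)))) :
    ∃ φ : FHat k × UnitIco → (FHat k ⧸ U.toSubgroup) × Fin m,
      (∀ x, φ ⁻¹' {x} ∈ algN k) ∧
      (∀ x, (volume : Measure (FHat k × UnitIco)).real (φ ⁻¹' {x}) =
        (volume : Measure (FHat k × UnitIco)).real (cellMap U m ⁻¹' {x})) ∧
      (∀ w z, φ (translate k w z) = FreeGroup.lift σ w (φ z)) ∧
      ∀ d ∈ D, ∀ z, φ z ∈ cellMap U m '' (d : Set (FHat k × UnitIco)) ↔
        z ∈ (d : Set (FHat k × UnitIco)) := by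
  classical
  have hlift := lift_mem_image_cellMap_iff hD hσ
  obtain ⟨ρ, hρo, hρ⟩ := exists_extension_toFHat σ
  -- The value `pr x` is the set of members of `D` containing the cell `x`, that is, the atom of the
  -- algebra generated by `D` in which `x` lies.
  let pr : (FHat k ⧸ U.toSubgroup) × Fin m → D → Prop := fun x d =>
    x ∈ cellMap U m '' (d.1 : Set (FHat k × UnitIco))
  obtain ⟨l, _, F, hF, hFc⟩ := exists_equidistributed_lift pr
    (fun j : Fin m => ((1 : FHat k ⧸ U.toSubgroup), j))
  let V : OpenNormalSubgroup (FHat k) :=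
    { toSubgroup := ρ.ker
      isOpen' := hρo {1}
      isNormal' := inferInstance }
  have hV : ∀ z z' : FHat k, (QuotientGroup.mk z : FHat k ⧸ V.toSubgroup) = QuotientGroup.mk z' →
      ρ z = ρ z' := by
    intro z z' h
    have h1 : ρ (z⁻¹ * z') = 1 := QuotientGroup.eq.1 h
    rw [map_mul, map_inv] at h1
    exact (inv_mul_eq_one.1 h1)
  -- This form makes equivariance automatic. Only the coset modulo the kernel `V` of `ρ` and the
  -- interval index matter, so the fibres belong to the algebra.
  let φ : FHat k × UnitIco → (FHat k ⧸ U.toSubgroup) × Fin m := fun z =>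
    ρ z.1 (F (ivl (m * l) z.2))
  have hφ : ∀ z z', cellMap V (m * l) z = cellMap V (m * l) z' → φ z = φ z' := by
    intro z z' h
    have h1 := hV _ _ (congrArg Prod.fst h)
    have h2 : ivl (m * l) z.2 = ivl (m * l) z'.2 := congrArg Prod.snd h
    change ρ z.1 (F (ivl (m * l) z.2)) = ρ z'.1 (F (ivl (m * l) z'.2))
    rw [h1, h2]
  have hφl : ∀ x, IsLevel V (m * l) (φ ⁻¹' {x}) := fun x z z' h => by
    rw [Set.mem_preimage, Set.mem_preimage, hφ z z' h]
  have hprF : ∀ t (d : D), pr (F (ivl (m * l) t)) d ↔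
      ((1 : FHat k), t) ∈ (d.1 : Set (FHat k × UnitIco)) := by
    intro t d
    rw [ivl_mul, hF, ← (hDl d.1 d.2).mem_image_iff]
    rfl
  have hprφ : ∀ z (d : D), pr (φ z) d ↔ z ∈ (d.1 : Set (FHat k × UnitIco)) := by
    intro z d
    -- A word close to `z.1` modulo `V` acts on cells as `ρ z.1` does; modulo `U` it cannot be told
    -- apart from `z.1` by members of `D`. This reduces the claim to the fibre over `1`, where it
    -- holds by the choice of `F`.
    obtain ⟨w, hw⟩ := exists_mk_toFHat_eq (U ⊓ V) z.1
    have h1 : (toFHat k w)⁻¹ * z.1 ∈ (U ⊓ V).toSubgroup := QuotientGroup.eq.1 hw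
    have h2 : ρ z.1 = FreeGroup.lift σ w := by
      rw [← hρ]
      exact (hV _ _ (QuotientGroup.eq.2 h1.2)).symm
    have h3 : (z ∈ (d.1 : Set (FHat k × UnitIco))) ↔
        (toFHat k w, z.2) ∈ (d.1 : Set (FHat k × UnitIco)) := by
      refine hDl d.1 d.2 _ _ (Prod.ext ?_ rfl)
      exact (QuotientGroup.eq.2 h1.1).symm
    obtain ⟨h4, h5⟩ := hlift w⁻¹ d.1 d.2
    have h6 := (hlift w _ h4).2 (F (ivl (m * l) z.2))
    have h7 : profiniteTimesTrivial k w (profiniteTimesTrivial k w⁻¹ d.1) = d.1 := by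
      rw [map_inv, aut_apply_inv_self]
    rw [h7] at h6
    have h8 := hprF z.2 ⟨_, h4⟩
    rw [mem_profiniteTimesTrivial_iff, inv_inv, translate_apply, mul_one] at h8
    rw [h3, ← h8]
    change ρ z.1 (F (ivl (m * l) z.2)) ∈ _ ↔ _
    rw [h2]
    exact h6
  -- Since `D` is invariant, `ρ` permutes the classes of cells not separated by `D`, and
  -- equidistribution of `F` on these classes passes to `φ`.
  have hprρ : ∀ (z : FHat k) x x', pr x = pr x' → pr ((ρ z)⁻¹ x) = pr ((ρ z)⁻¹ x') := by
    intro z x x' h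
    obtain ⟨w, hw⟩ := exists_mk_toFHat_eq V z
    have h2 : (ρ z)⁻¹ = FreeGroup.lift σ w⁻¹ := by
      rw [map_inv, ← hρ, hV _ _ hw]
    funext d
    obtain ⟨h4, h5⟩ := hlift w d.1 d.2
    have h6 := (hlift w⁻¹ _ h4).2
    have h7 : profiniteTimesTrivial k w⁻¹ (profiniteTimesTrivial k w d.1) = d.1 := by
      rw [map_inv, aut_inv_apply_self]
    rw [h7] at h6
    rw [h2]
    exact propext ((h6 x).trans ((iff_of_eq (congrFun h ⟨_, h4⟩)).trans (h6 x').symm))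
  refine ⟨φ, fun x => (hφl x).mem_tensor, ?_, ?_, fun d hd z => hprφ z ⟨d, hd⟩⟩
  · refine distribution_eq_of_comp_eq (pr := pr) _ (fun x => (hφl x).measurableSet)
      (fun x => measurableSet_preimage_cellMap U m {x}) (fun z => ?_) ?_ ?_
    · funext d
      exact propext ((hprφ z d).trans ((hDl d.1 d.2).mem_image_iff z).symm)
    · intro x x' hx
      have hS : ∀ x, φ ⁻¹' {x} = cellMap V (m * l) ⁻¹' {y | ρ y.1.out (F y.2) = x} := by
        intro x
        ext z
        rw [Set.mem_preimage, Set.mem_preimage, Set.mem_ofPred_eq, Set.mem_singleton_iff]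
        have : ρ (QuotientGroup.mk z.1 : FHat k ⧸ V.toSubgroup).out = ρ z.1 :=
          hV _ _ (Quotient.out_eq _)
        change ρ z.1 (F (ivl (m * l) z.2)) = x ↔
          ρ (QuotientGroup.mk z.1 : FHat k ⧸ V.toSubgroup).out (F (ivl (m * l) z.2)) = x
        rw [this]
      -- The cells with value `x` are counted coset by coset: over `q` they are the indices at which
      -- `F` takes the value `(ρ q.out)⁻¹ x`.
      have hcard : ∀ x, Nat.card {y : (FHat k ⧸ V.toSubgroup) × Fin (m * l) |
          ρ y.1.out (F y.2) = x} =
          Nat.card (Σ q : FHat k ⧸ V.toSubgroup, {j // F j = (ρ q.out)⁻¹ x}) := by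
        intro x
        refine Nat.card_congr
          { toFun := fun y => ⟨y.1.1, y.1.2, (Equiv.Perm.eq_inv_iff_eq).2 y.2⟩
            invFun := fun y => ⟨(y.1, y.2.1), (Equiv.Perm.eq_inv_iff_eq).1 y.2.2⟩
            left_inv := fun _ => rfl
            right_inv := fun _ => rfl }
      have := Fintype.ofFinite (FHat k ⧸ V.toSubgroup)
      rw [hS, hS, volume_real_preimage_cellMap, volume_real_preimage_cellMap, hcard, hcard,
        Nat.card_sigma, Nat.card_sigma,
        Finset.sum_congr rfl fun q _ => hFc _ _ (hprρ q.out x x' hx)]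
    · intro x x' _
      rw [volume_real_preimage_cellMap, volume_real_preimage_cellMap]
      simp
  · intro w z
    change ρ (toFHat k w * z.1) (F (ivl (m * l) z.2)) = _
    rw [map_mul, hρ]
    rfl

/-- The automorphism `h` carrying the cell map to `φ` fixes `D` because `φ z` lies in the cells of
`d` exactly when `z` lies in `d`. It intertwines `f i` with the action on `A` because `σ i`
implements `f i` on cells and `φ` is equivariant. -/
theorem isGenericAction_profiniteTimesTrivial (k : ℕ) [Countable (algN k)] :
    IsGenericAction (profiniteTimesTrivial k) := by
  refine diagonalConjClass_mem_residual exists_finite_invariant fun D A f hD hf => ?_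
  classical
  -- The level must accommodate the images under `f` too, so that each `f i` can be implemented by a
  -- permutation of the same cells.
  let s : Set (Set (FHat k × UnitIco)) := (fun a : algN k => (a : Set (FHat k × UnitIco))) ''
    (↑(D ∪ A) ∪ ⋃ i, f i '' ↑(D ∪ A))
  obtain ⟨U, m, _, hL⟩ := exists_isLevel_of_finite (s := s)
    (((D ∪ A).finite_toSet.union (Set.finite_iUnion fun i =>
      (D ∪ A).finite_toSet.image _)).image _) (by rintro _ ⟨a, -, rfl⟩; exact a.2)
  have hl : ∀ a ∈ D ∪ A, IsLevel U m (a : Set (FHat k × UnitIco)) := fun a ha =>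
    hL _ ⟨a, Or.inl ha, rfl⟩
  have hlf : ∀ i, ∀ a ∈ D ∪ A, IsLevel U m (f i a : Set (FHat k × UnitIco)) := fun i a ha =>
    hL _ ⟨_, Or.inr (Set.mem_iUnion.2 ⟨i, a, ha, rfl⟩), rfl⟩
  have hperm : ∀ i, ∃ σ : Equiv.Perm ((FHat k ⧸ U.toSubgroup) × Fin m), ∀ a ∈ D ∪ A, ∀ x,
      (σ x ∈ cellMap U m '' (f i a : Set (FHat k × UnitIco)) ↔
        x ∈ cellMap U m '' (a : Set (FHat k × UnitIco))) := by
    intro i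
    obtain ⟨σ, hσ⟩ := exists_perm_cells (G := FHat k)
      (FirstOrder.Language.Embedding.refl mbaLang (algN k)) (f i).toEmbedding
      (fun a : {a // a ∈ D ∪ A} => a.1) (fun a => hl a.1 a.2) (fun a => hlf i a.1 a.2)
    exact ⟨σ, fun a ha => hσ ⟨a, ha⟩⟩
  choose σ hσ using hperm
  obtain ⟨φ, hφ, hφv, hφe, hφD⟩ := exists_equivariant_map hD
    (fun d hd => hl d (Finset.mem_union_left A hd)) (σ := σ) (fun i d hd x => by
      rw [← hf i d hd]
      exact hσ i d (Finset.mem_union_left A hd) x)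
  obtain ⟨h, hh⟩ : ∃ h : algN k ≃[mbaLang] algN k, ∀ (a : algN k) (S : Set _),
      (a : Set (FHat k × UnitIco)) = cellMap U m ⁻¹' S →
        (h a : Set (FHat k × UnitIco)) = φ ⁻¹' S := exists_aut_of_distribution_eq (G := FHat k)
    (fun x => (isLevel_preimage U m {x}).mem_tensor) hφ (fun x => (hφv x).symm)
  have hh' : ∀ a : algN k, IsLevel U m (a : Set (FHat k × UnitIco)) → ∀ z,
      (z ∈ (h a : Set (FHat k × UnitIco)) ↔
        φ z ∈ cellMap U m '' (a : Set (FHat k × UnitIco))) := fun a ha z => by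
    rw [hh a _ ha.preimage_image.symm]
    rfl
  refine ⟨h, fun d hd => ?_, fun i a ha => ?_⟩
  · apply Subtype.ext
    ext z
    rw [hh' d (hl d (Finset.mem_union_left A hd)), hφD d hd]
  · have ha' := Finset.mem_union_right D ha
    apply Subtype.ext
    ext z
    rw [hh' _ (hlf i a ha'), mem_profiniteTimesTrivial_iff, hh' _ (hl a ha'), hφe,
      ← hσ i a ha', map_inv, FreeGroup.lift_apply_of]
    exact iff_of_eq (congrArg (· ∈ _) ((σ i).apply_symm_apply (φ z)).symm)

theorem countable_algN (k : ℕ) : Countable (algN k) :=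
  have := countable_openNormalSubgroup_fHat k
  countable_rectAlg (G := FHat k)

end Generic

end PmpFree

theorem theorem6 (k : ℕ) :
    (∃ _ : Countable (PmpFree.algN k),
      FirstOrder.Language.IsFraisseLimit PmpFree.mbaQ (PmpFree.algN k)) ∧
    PmpFree.IsGenericAction (PmpFree.profiniteTimesTrivial k) := by
  have := PmpFree.countable_algN k
  have : Countable (PmpFree.rectAlg (PmpFree.FHat k)) := this
  exact ⟨⟨this, PmpFree.isFraisseLimit_rectAlg (G := PmpFree.FHat k)⟩,
    PmpFree.isGenericAction_profiniteTimesTrivial k⟩
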